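/- Let $d\ge 1$, and let $\mathcal P_\ell=\{A_{\ell,1},\dots,A_{\ell,m_\ell}\}$, $\ell=1,2,\dots$, be finite partitions of $\mathbb R^d$ into Borel sets such that every cell of $\mathcal P_{\ell+1}$ is contained in a cell of $\mathcal P_\ell$, and such that for every ball $S$ centered at the origin $$\lim_{\ell\to\infty}\ \max_{j:\,A_{\ell,j}\cap S\neq\emptyset}\operatorname{diam}(A_{\ell,j})=0 .$$ Let $G_\ell(x)=j$ if $x\in A_{\ell,j}$, and let $G_\ell$ act on finite sequences coordinatewise. Write $a_i^j=(a_i,\dots,a_j)$. For $k,\ell\ge 1$, $y\in\{0,1\}$, $s\in\{0,1\}^k$, $z\in\{1,\dots,m_\ell\}^{k+1}$ and $n>k+1$ put $$\widehat P_n^{(k,\ell)}(y,y_1^{n-1},x_1^n,s,z)=\frac{\left|\{k<i<n:\ y_{i-k}^{i-1}=s,\ G_\ell(x_{i-k}^{i})=z,\ y_i=y\}\right|}{\left|\{k<i<n:\ y_{i-k}^{i-1}=s,\ G_\ell(x_{i-k}^{i})=z\}\right|},\qquad \tfrac00:=\tfrac12,$$ and let $\widehat P_n^{(k,\ell)}=\frac12$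 for $n\le k+1$. The expert $h^{(k,\ell)}$ predicts at time $n\ge 1$ $$h_n^{(k,\ell)}(y_1^{n-1},x_1^n)=\begin{cases}0 & \text{if } \widehat P_n^{(k,\ell)}\bigl(0,y_1^{n-1},x_1^n,y_{n-k}^{n-1},G_\ell(x_{n-k}^n)\bigr)>\frac12,\\ 1&\text{otherwise.}\end{cases}$$ For an expert $h$ and $a\le b$ let $R_a^b(h)=\frac1{b-a+1}\sum_{i=a}^b I_{\{h_i(y_1^{i-1},x_1^i)\ne y_i\}}$. For $m\ge 0$ and $2^m\le n<2^{m+1}$ let $\eta_m=\sqrt{8\ln\bigl((2^{m+1})^2\bigr)/2^m}$, let $w_{2^m}(k,\ell)=1$ and $w_n(k,\ell)=e^{-\eta_m(n-2^m)R_{2^m}^{n-1}(h^{(k,\ell)})}$ for $2^m<n<2^{m+1}$, and define, for $u\in[0,1]$, $$g_n(y_1^{n-1},x_1^n,u)=\begin{cases}0&\text{if } u>\dfrac{\sum_{1\le k,\ell\le 2^{m+1}}h_n^{(k,\ell)}(y_1^{n-1},x_1^n)\,w_n(k,\ell)}{\sum_{1\le k,\ell\le 2^{m+1}}w_n(k,\ell)},\\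 1&\text{otherwise.}\end{cases}$$ Then for every stationary and ergodic process $\{(X_n,Y_n)\}_{n=-\infty}^{\infty}$ with values in $\mathbb R^d\times\{0,1\}$ and every sequence $U_1,U_2,\dots$ of i.i.d. random variables, uniformly distributed on $[0,1]$ and independent of the process, $$\lim_{n\to\infty}\frac1n\sum_{i=1}^n I_{\{g_i(Y_1^{i-1},X_1^i,U_i)\ne Y_i\}}=R^*\quad\text{almost surely,}$$ where $$R^*=\mathbf E\left[\min\left(\mathbf P\{Y_0=1\mid Y_{-\infty}^{-1},X_{-\infty}^0\},\ \mathbf P\{Y_0=0\mid Y_{-\infty}^{-1},X_{-\infty}^0\}\right)\right].$$ -/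

import Mathlib

open MeasureTheory ProbabilityTheory Filter Topology

noncomputable section

namespace PatternPrediction

/-- A finite partition `{A_1, …, A_m}` of `E`, given by its (possibly empty) indexed cells. -/
structure FinitePartition (E : Type*) where
  /-- the number of cells -/
  size : ℕ
  /-- the cells -/
  cell : Fin size → Set E
  disjoint_cell : ∀ i j, i ≠ j → Disjoint (cell i) (cell j)
  cover : ∀ x, ∃ j, x ∈ cell j

/-- The quantizer `G` of a finite partition: `G x = j` if `x ∈ A_j`. -/
def FinitePartition.quantizer {E : Type*} (P : FinitePartition E) (x : E) : Fin P.size :=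
  (P.cover x).choose

theorem FinitePartition.quantizer_eq_iff {E : Type*} (P : FinitePartition E) (x : E)
    (j : Fin P.size) : P.quantizer x = j ↔ x ∈ P.cell j := by
  have hx : x ∈ P.cell (P.quantizer x) := (P.cover x).choose_spec
  refine ⟨fun h => h ▸ hx, fun h => ?_⟩
  by_contra hne
  exact Set.disjoint_left.mp (P.disjoint_cell _ _ hne) hx h

/-- `Q` refines `P`: every cell of `Q` is a subset of a cell of `P`. -/
def FinitePartition.Refines {E : Type*} (Q P : FinitePartition E) : Prop :=
  ∀ j, ∃ i, Q.cell j ⊆ P.cell i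

/-- The largest diameter, in `[0, ∞]`, of those cells of `P` that meet the set `S`. -/
def FinitePartition.maxDiamOn {E : Type*} [PseudoEMetricSpace E]
    (P : FinitePartition E) (S : Set E) : ENNReal :=
  ⨆ j : Fin P.size, ⨆ _ : (P.cell j ∩ S).Nonempty, Metric.ediam (P.cell j)

/-- The block `a_s, a_{s+1}, …, a_{s+len-1}` of a sequence. -/
def block {α : Type*} (a : ℕ → α) (s len : ℕ) : Fin len → α := fun j => a (s + j)

/-! Outcomes `y_1, y_2, …` and side information `x_1, x_2, …` are sequences indexed by `ℕ` of which
only the terms with positive index are ever used; the prediction at time `n` uses only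
`y_1, …, y_{n-1}` and `x_1, …, x_n`. -/

/-- The times `i` with `k < i < n`, `y_{i-k}^{i-1} = s` and `G(x_{i-k}^i) = z`. -/
def matchTimes {E : Type*} (P : FinitePartition E) (k n : ℕ) (y : ℕ → Fin 2) (x : ℕ → E)
    (s : Fin k → Fin 2) (z : Fin (k + 1) → Fin P.size) : Finset ℕ :=
  (Finset.Ioo k n).filter fun i =>
    block y (i - k) k = s ∧ block (fun t => P.quantizer (x t)) (i - k) (k + 1) = z

/-- The relative frequency of the bit `b` after the matches of `(s, z)`, with `0 / 0 = 1 / 2`, and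
`1 / 2` if `n ≤ k + 1`. -/
def empFreq {E : Type*} (P : FinitePartition E) (k n : ℕ) (b : Fin 2)
    (y : ℕ → Fin 2) (x : ℕ → E) (s : Fin k → Fin 2) (z : Fin (k + 1) → Fin P.size) : ℝ :=
  if n ≤ k + 1 ∨ (matchTimes P k n y x s z).card = 0 then 1 / 2
  else (((matchTimes P k n y x s z).filter fun i => y i = b).card : ℝ) /
    ((matchTimes P k n y x s z).card : ℝ)

/-- The prediction at time `n` of the expert of order `k` that quantizes by `P`: it looks for the
last seen quantized context in the past and predicts by the larger relative frequency. -/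
def expert {E : Type*} (P : FinitePartition E) (k n : ℕ) (y : ℕ → Fin 2) (x : ℕ → E) : Fin 2 :=
  if 1 / 2 < empFreq P k n 0 y x (block y (n - k) k)
      (block (fun t => P.quantizer (x t)) (n - k) (k + 1)) then 0 else 1

/-- The average number of mistakes between times `a` and `b` of the predictions `p_a, …, p_b`. -/
def avgLoss (p y : ℕ → Fin 2) (a b : ℕ) : ℝ :=
  (∑ i ∈ Finset.Icc a b, if p i ≠ y i then (1 : ℝ) else 0) / ((b : ℝ) - a + 1)

/-- `η_m = √(8 ln((2^{m+1})²) / 2^m)`, where `(2^{m+1})²` is the number of experts in use. -/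
def learningRate (m : ℕ) : ℝ :=
  Real.sqrt (8 * Real.log (((2 : ℝ) ^ (m + 1)) ^ 2) / 2 ^ m)

/-- The weight at time `n`, `2^m ≤ n < 2^{m+1}` (so `m = Nat.log 2 n`), of the expert of order `k`
that quantizes by `P`. -/
def weight {E : Type*} (P : FinitePartition E) (k n : ℕ) (y : ℕ → Fin 2) (x : ℕ → E) : ℝ :=
  let m := Nat.log 2 n
  if n = 2 ^ m then 1
  else Real.exp (-learningRate m * ((n : ℝ) - 2 ^ m) *
    avgLoss (fun i => expert P k i y x) y (2 ^ m) (n - 1))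

/-- The randomized scheme `g` at time `n ≥ 1`, `2^m ≤ n < 2^{m+1}`: the weighted majority vote over
the experts with `1 ≤ k, ℓ ≤ 2^{m+1}`, where `u` is the randomizing variable. -/
def scheme {E : Type*} (P : ℕ → FinitePartition E) (n : ℕ) (y : ℕ → Fin 2) (x : ℕ → E)
    (u : ℝ) : Fin 2 :=
  let N := 2 ^ (Nat.log 2 n + 1)
  if u > (∑ k ∈ Finset.Icc 1 N, ∑ l ∈ Finset.Icc 1 N,
        ((expert (P l) k n y x : ℕ) : ℝ) * weight (P l) k n y x) /
      (∑ k ∈ Finset.Icc 1 N, ∑ l ∈ Finset.Icc 1 N, weight (P l) k n y x)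
  then 0 else 1

/-- `R_1^n(g) = R_1^n(g, u_1^n)`, the normalized cumulative loss of the scheme `g`. -/
def schemeLoss {E : Type*} (P : ℕ → FinitePartition E) (n : ℕ) (y : ℕ → Fin 2) (x : ℕ → E)
    (u : ℕ → ℝ) : ℝ :=
  avgLoss (fun i => scheme P i y x (u i)) y 1 n

/-- The left shift on two-sided sequences. -/
def shift {α : Type*} (a : ℤ → α) : ℤ → α := fun n => a (n + 1)

/-- A two-sided process is stationary and ergodic: the shift preserves its law and is ergodic for
it. -/
def IsStationaryErgodic {Ω α : Type*} [MeasurableSpace Ω] [MeasurableSpace α]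
    (μ : Measure Ω) (Z : ℤ → Ω → α) : Prop :=
  Ergodic shift (μ.map fun ω n => Z n ω)

/-- The σ-algebra generated by `Y_{-∞}^{-1}` and `X_{-∞}^0`. -/
abbrev pastSigma {Ω E : Type*} [MeasurableSpace E] (X : ℤ → Ω → E) (Y : ℤ → Ω → Fin 2) :
    MeasurableSpace Ω :=
  (⨆ n : ℤ, ⨆ _ : n ≤ -1, MeasurableSpace.comap (Y n) inferInstance) ⊔
    ⨆ n : ℤ, ⨆ _ : n ≤ 0, MeasurableSpace.comap (X n) inferInstance

/-- The Bayes error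
`R^* = E[min(P{Y_0 = 1 | Y_{-∞}^{-1}, X_{-∞}^0}, P{Y_0 = 0 | Y_{-∞}^{-1}, X_{-∞}^0})]`. -/
def bayesError {Ω E : Type*} [MeasurableSpace Ω] [MeasurableSpace E] (μ : Measure Ω)
    (X : ℤ → Ω → E) (Y : ℤ → Ω → Fin 2) : ℝ :=
  ∫ ω, min ((μ⟦{ω' | Y 0 ω' = 1}|pastSigma X Y⟧) ω)
    ((μ⟦{ω' | Y 0 ω' = 0}|pastSigma X Y⟧) ω) ∂μ

end PatternPrediction

end

/-! Conditionally on the past, predicting 1 with probability `p` when the next bit has posterior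
probability `f` costs `p + f - 2 * p * f = (1 - p) * f + p * (1 - f)`, which is at least `min f (1 -
f)`. By the ergodic theorem the time average of these minima along a trajectory is the Bayes error,
and it remains to see that nothing else survives averaging.

The realized loss differs from the conditional risk by two noise terms. The randomization error has
mean zero given the trajectory, independently over time (`ae_tendsto_timeAvg_threshold`). The
outcome error `(1 - 2 * p) * (y - f)` is a martingale difference
(`ae_tendsto_timeAvg_mul_sub_posterior`). Both are bounded and pairwise orthogonal, so both average
to zero almost surely by `ae_tendsto_sum_div_of_orthogonal`. This already gives the lower bound.

For the upper bound, exponential weighting, restarted on dyadic blocks, makes the vote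
asymptotically no worse than any fixed expert, on every individual sequence (`exists_regret`). The
frequencies an expert uses converge to the conditional probability given its finite quantized
context (`ae_tendsto_estimate_sub`), so its limiting risk exceeds the Bayes error by at most twice
the L¹ distance between context posterior and full posterior (`ae_expert_risk`). Along `k = ℓ` the
contexts generate increasing σ-algebras whose join is the whole past (`iSup_contextFiltration`), and
Lévy's upward theorem sends this distance to zero. -/

namespace PatternPrediction

/-! ### The maximal inequality and Birkhoff's theorem for bounded functions -/

section Ergodic

variable {α : Type*} {T : α → α} {g : α → ℝ}

/-- The running maximum of `0` and the first `n` Birkhoff sums. -/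
def maxBirkhoffSum (T : α → α) (g : α → ℝ) : ℕ → α → ℝ
  | 0 => fun _ => 0
  | n + 1 => fun x => max 0 (g x + maxBirkhoffSum T g n (T x))

theorem maxBirkhoffSum_nonneg (n : ℕ) (x : α) : 0 ≤ maxBirkhoffSum T g n x := by
  cases n with
  | zero => exact le_rfl
  | succ n => exact le_max_left _ _

theorem maxBirkhoffSum_le_succ (n : ℕ) (x : α) :
    maxBirkhoffSum T g n x ≤ maxBirkhoffSum T g (n + 1) x := by
  induction n generalizing x with
  | zero => exact maxBirkhoffSum_nonneg 1 x
  | succ n ih =>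
    have := ih (T x)
    simp only [maxBirkhoffSum] at this ⊢
    gcongr

theorem maxBirkhoffSum_mono (x : α) : Monotone fun n => maxBirkhoffSum T g n x :=
  monotone_nat_of_le_succ fun n => maxBirkhoffSum_le_succ n x

theorem birkhoffSum_le_maxBirkhoffSum (n : ℕ) (x : α) :
    birkhoffSum T g n x ≤ maxBirkhoffSum T g n x := by
  induction n generalizing x with
  | zero => simp [maxBirkhoffSum]
  | succ n ih =>
    rw [birkhoffSum_succ']
    exact le_max_of_le_right (by gcongr; exact ih _)

theorem maxBirkhoffSum_le {C : ℝ} (hC : ∀ x, |g x| ≤ C) (n : ℕ) (x : α) :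
    maxBirkhoffSum T g n x ≤ n * C := by
  have hC0 : 0 ≤ C := (abs_nonneg _).trans (hC x)
  induction n generalizing x with
  | zero => simp [maxBirkhoffSum]
  | succ n ih =>
    refine max_le (by positivity) ?_
    have h1 := (abs_le.mp (hC x)).2
    have h2 := ih (T x)
    push_cast
    linarith

variable [MeasurableSpace α] {μ : Measure α}

theorem measurable_maxBirkhoffSum (hT : Measurable T) (hg : Measurable g) (n : ℕ) :
    Measurable (maxBirkhoffSum T g n) := by
  induction n with
  | zero => exact measurable_const
  | succ n ih => exact measurable_const.max (hg.add (ih.comp hT))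

theorem integrable_of_measurable_of_abs_le [IsFiniteMeasure μ] {f : α → ℝ} (hf : Measurable f)
    {C : ℝ} (hC : ∀ x, |f x| ≤ C) : Integrable f μ :=
  Integrable.of_bound hf.aestronglyMeasurable C (ae_of_all _ hC)

/-- The maximal ergodic theorem, for bounded functions. -/
theorem integral_indicator_maxBirkhoffSum_nonneg [IsProbabilityMeasure μ]
    (hT : MeasurePreserving T μ μ) (hg : Measurable g) {C : ℝ} (hC : ∀ x, |g x| ≤ C) (n : ℕ) :
    0 ≤ ∫ x, {x | 0 < maxBirkhoffSum T g n x}.indicator g x ∂μ := by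
  cases n with
  | zero => simp [maxBirkhoffSum]
  | succ n =>
    set M := maxBirkhoffSum T g (n + 1) with hM
    have hMm : Measurable M := measurable_maxBirkhoffSum hT.measurable hg _
    have hMi : Integrable M μ := integrable_of_measurable_of_abs_le hMm
      (C := ((n + 1 : ℕ) : ℝ) * C) fun x => by
        rw [abs_of_nonneg (maxBirkhoffSum_nonneg _ _)]; exact maxBirkhoffSum_le hC _ _
    have hMT : Integrable (fun x => M (T x)) μ := hT.integrable_comp_of_integrable hMi
    have hint : ∫ x, M (T x) ∂μ = ∫ x, M x ∂μ := by
      conv_rhs => rw [← hT.map_eq]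
      rw [integral_map hT.measurable.aemeasurable hMm.aestronglyMeasurable]
    -- Garsia's argument: where `M` is positive the recursion gives `M ≤ g + M ∘ T`, and elsewhere
    -- `M = 0 ≤ M ∘ T`. The left side integrates to zero by invariance.
    have hle : ∫ x, (M x - M (T x)) ∂μ ≤ ∫ x, {x | 0 < M x}.indicator g x ∂μ := by
      refine integral_mono (hMi.sub hMT)
        ((integrable_of_measurable_of_abs_le hg hC).indicator
          (measurableSet_lt measurable_const hMm)) fun x => ?_
      by_cases hx : 0 < M x
      · rw [Set.indicator_of_mem (by exact hx)]
        have h1 : M x = g x + maxBirkhoffSum T g n (T x) := by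
          have h2 : M x = max 0 (g x + maxBirkhoffSum T g n (T x)) := rfl
          rcases max_choice 0 (g x + maxBirkhoffSum T g n (T x)) with h | h
          · rw [h] at h2; exact absurd h2 hx.ne'
          · rw [h] at h2; exact h2
        have h3 := maxBirkhoffSum_le_succ (T := T) (g := g) n (T x)
        rw [← hM] at h3
        simp only
        linarith
      · rw [Set.indicator_of_notMem (by exact hx)]
        have h1 : 0 ≤ M (T x) := maxBirkhoffSum_nonneg _ _
        simp only
        linarith
    rwa [integral_sub hMi hMT, hint, sub_self] at hle

/-- The sets in the maximal inequality increase with `n` and exhaust almost every point, so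
dominated convergence removes the indicator. -/
theorem integral_nonneg_of_exists_birkhoffSum_pos [IsProbabilityMeasure μ]
    (hT : MeasurePreserving T μ μ) (hg : Measurable g) {C : ℝ} (hC : ∀ x, |g x| ≤ C)
    (h : ∀ᵐ x ∂μ, ∃ n, 0 < birkhoffSum T g n x) : 0 ≤ ∫ x, g x ∂μ := by
  refine ge_of_tendsto' (x := atTop) (f := fun n : ℕ =>
    ∫ x, {x | 0 < maxBirkhoffSum T g n x}.indicator g x ∂μ) ?_
    (fun n => integral_indicator_maxBirkhoffSum_nonneg hT hg hC n)
  refine tendsto_integral_of_dominated_convergence (fun _ => C)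
    (fun n => (hg.indicator (measurableSet_lt measurable_const
      (measurable_maxBirkhoffSum hT.measurable hg n))).aestronglyMeasurable)
    (integrable_const _) (fun n => ae_of_all _ fun x => ?_) ?_
  · exact (norm_indicator_le_norm_self _ _).trans (hC x)
  · filter_upwards [h] with x ⟨n, hn⟩
    refine tendsto_const_nhds.congr' ?_
    filter_upwards [eventually_ge_atTop n] with k hk
    rw [Set.indicator_of_mem]
    exact (hn.trans_le (birkhoffSum_le_maxBirkhoffSum n x)).trans_le (maxBirkhoffSum_mono x hk)

theorem measurable_birkhoffSum (hT : Measurable T) (hg : Measurable g) (n : ℕ) :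
    Measurable (birkhoffSum T g n) :=
  Finset.measurable_sum _ fun i _ => hg.comp (hT.iterate i)

/-- The set of points with unbounded sums is invariant, hence null or of full measure. Full measure
would force a nonnegative integral by the maximal inequality. -/
theorem ae_bddAbove_birkhoffSum_of_integral_neg [IsProbabilityMeasure μ] (hT : Ergodic T μ)
    (hg : Measurable g) {C : ℝ} (hC : ∀ x, |g x| ≤ C) (hneg : ∫ x, g x ∂μ < 0) :
    ∀ᵐ x ∂μ, ∃ a : ℕ, ∀ n, birkhoffSum T g n x ≤ a := by
  set A : Set α := {x | ∀ a : ℕ, ∃ n, (a : ℝ) < birkhoffSum T g n x} with hA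
  have hAm : MeasurableSet A := by
    simp only [hA, Set.ofPred_forall, Set.ofPred_exists]
    exact MeasurableSet.iInter fun a => MeasurableSet.iUnion fun n =>
      measurableSet_lt measurable_const (measurable_birkhoffSum hT.measurable hg n)
  obtain ⟨c, hc⟩ := exists_nat_ge C
  -- Passing from `x` to `T x` changes the sums by `g x`, at most `c` in size; asking for the level
  -- `a + c` absorbs this.
  have hinv : T ⁻¹' A = A := by
    ext x
    have hx := abs_le.mp ((hC x).trans hc)
    refine ⟨fun h a => ?_, fun h a => ?_⟩
    · obtain ⟨n, hn⟩ := h (a + c)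
      refine ⟨n + 1, ?_⟩
      rw [birkhoffSum_succ']
      push_cast at hn
      linarith
    · obtain ⟨n, hn⟩ := h (a + c)
      cases n with
      | zero =>
        simp only [birkhoffSum_zero] at hn
        exact absurd hn (not_lt.mpr (by positivity))
      | succ n =>
        refine ⟨n, ?_⟩
        rw [birkhoffSum_succ'] at hn
        push_cast at hn
        linarith
  rcases hT.toPreErgodic.ae_mem_or_ae_notMem hAm hinv with h | h
  · refine absurd (integral_nonneg_of_exists_birkhoffSum_pos hT.toMeasurePreserving hg hC ?_)
      (not_le.mpr hneg)
    filter_upwards [h] with x hx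
    obtain ⟨n, hn⟩ := hx 0
    exact ⟨n, by simpa using hn⟩
  · filter_upwards [h] with x hx
    simpa [hA] using hx

/-- Subtracting slightly more than the mean makes the integral negative, so the centered sums stay
bounded. Countably many margins `1 / (j + 1)` give one null set for all `ε`. -/
theorem ae_eventually_birkhoffSum_le [IsProbabilityMeasure μ] (hT : Ergodic T μ)
    (hg : Measurable g) {C : ℝ} (hC : ∀ x, |g x| ≤ C) :
    ∀ᵐ x ∂μ, ∀ ε > 0, ∀ᶠ n : ℕ in atTop, birkhoffSum T g n x ≤ (∫ x, g x ∂μ + ε) * n := by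
  have key : ∀ j : ℕ, ∀ᵐ x ∂μ, ∃ a : ℕ, ∀ n,
      birkhoffSum T (fun x => g x - (∫ x, g x ∂μ + 1 / ((j : ℝ) + 1))) n x ≤ a := by
    intro j
    refine ae_bddAbove_birkhoffSum_of_integral_neg hT (hg.sub_const _)
      (C := C + |∫ x, g x ∂μ + 1 / ((j : ℝ) + 1)|) (fun x => ?_) ?_
    · exact (abs_sub _ _).trans (by gcongr; exact hC x)
    · rw [integral_sub (integrable_of_measurable_of_abs_le hg hC) (integrable_const _)]
      have : 0 < 1 / ((j : ℝ) + 1) := by positivity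
      simp only [integral_const, probReal_univ, one_smul]
      linarith
  filter_upwards [ae_all_iff.mpr key] with x hx ε hε
  obtain ⟨j, hj⟩ := exists_nat_one_div_lt (half_pos hε)
  obtain ⟨a, ha⟩ := hx j
  obtain ⟨N, hN⟩ := exists_nat_ge (a / (ε / 2))
  filter_upwards [eventually_ge_atTop N] with n hn
  have h1 := ha n
  simp only [birkhoffSum, Finset.sum_sub_distrib, Finset.sum_const, Finset.card_range,
    nsmul_eq_mul] at h1 ⊢
  have h2 : (a : ℝ) ≤ n * (ε / 2) := by
    rw [div_le_iff₀ (by positivity)] at hN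
    exact hN.trans (by gcongr)
  have h3 : (n : ℝ) * (1 / ((j : ℝ) + 1)) ≤ n * (ε / 2) := by gcongr
  linarith

/-- Birkhoff's pointwise ergodic theorem, for bounded functions. -/
theorem ae_tendsto_birkhoffSum_div [IsProbabilityMeasure μ] (hT : Ergodic T μ)
    (hg : Measurable g) {C : ℝ} (hC : ∀ x, |g x| ≤ C) :
    ∀ᵐ x ∂μ, Tendsto (fun n : ℕ => birkhoffSum T g n x / n) atTop (𝓝 (∫ x, g x ∂μ)) := by
  filter_upwards [ae_eventually_birkhoffSum_le hT hg hC,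
    ae_eventually_birkhoffSum_le hT hg.neg (C := C) (fun x => by simpa using hC x)] with x h1 h2
  rw [Metric.tendsto_nhds]
  intro ε hε
  filter_upwards [h1 _ (half_pos hε), h2 _ (half_pos hε), eventually_gt_atTop 0] with n h3 h4 hn
  have hn' : (0 : ℝ) < n := by exact_mod_cast hn
  simp only [Pi.neg_apply, integral_neg, birkhoffSum, Finset.sum_neg_distrib] at h3 h4 ⊢
  rw [Real.dist_eq, abs_lt]
  constructor
  · rw [lt_sub_iff_add_lt, lt_div_iff₀ hn']
    nlinarith
  · rw [sub_lt_iff_lt_add, div_lt_iff₀ hn']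
    nlinarith

end Ergodic

/-! ### A strong law for bounded orthogonal variables -/

section Orthogonal

variable {Ω : Type*} [MeasurableSpace Ω] {μ : Measure Ω}

/-- Between consecutive squares `r ^ 2` and `(r + 1) ^ 2` at most `2 * r` further bounded terms
enter, which is negligible against `r ^ 2`. -/
theorem tendsto_sum_div_of_tendsto_sq {a : ℕ → ℝ} {C : ℝ} (hC : ∀ i, |a i| ≤ C)
    (h : Tendsto (fun n : ℕ => (∑ i ∈ Finset.range (n ^ 2), a i) / (n : ℝ) ^ 2) atTop (𝓝 0)) :
    Tendsto (fun n : ℕ => (∑ i ∈ Finset.range n, a i) / n) atTop (𝓝 0) := by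
  have hC0 : 0 ≤ C := (abs_nonneg _).trans (hC 0)
  have hsqrt : Tendsto Nat.sqrt atTop atTop :=
    tendsto_atTop.mpr fun b => by
      filter_upwards [eventually_ge_atTop (b ^ 2)] with n hn
      exact Nat.le_sqrt'.mpr hn
  have h1 : Tendsto (fun r : ℕ => |(∑ i ∈ Finset.range (r ^ 2), a i) / (r : ℝ) ^ 2| +
      2 * C / r) atTop (𝓝 0) := by
    simpa using h.abs.add (tendsto_const_div_atTop_nhds_zero_nat (2 * C))
  refine squeeze_zero_norm' ?_ (h1.comp hsqrt)
  filter_upwards [eventually_ge_atTop 1] with n hn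
  set r := Nat.sqrt n with hr
  have hr1 : 1 ≤ r := Nat.le_sqrt'.mpr (by simpa using hn)
  have hrn : r ^ 2 ≤ n := Nat.sqrt_le' n
  have hnr : n ≤ r ^ 2 + 2 * r := by
    have := Nat.sqrt_le_add n
    rw [← hr] at this
    nlinarith
  have hr0 : (0 : ℝ) < r := by exact_mod_cast hr1
  have hrn' : (r : ℝ) ^ 2 ≤ n := by exact_mod_cast hrn
  have hnr' : (n : ℝ) ≤ (r : ℝ) ^ 2 + 2 * r := by exact_mod_cast hnr
  have hn0 : (0 : ℝ) < n := lt_of_lt_of_le (by positivity) hrn'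
  have h2 : |∑ i ∈ Finset.range n, a i| ≤ |∑ i ∈ Finset.range (r ^ 2), a i| + 2 * r * C := by
    rw [← Finset.sum_range_add_sum_Ico _ hrn]
    refine (abs_add_le _ _).trans ?_
    gcongr
    refine (Finset.abs_sum_le_sum_abs _ _).trans
      ((Finset.sum_le_card_nsmul _ _ C fun i _ => hC i).trans ?_)
    rw [Nat.card_Ico, nsmul_eq_mul, Nat.cast_sub hrn]
    gcongr
    push_cast
    linarith
  simp only [Function.comp, Real.norm_eq_abs, abs_div, abs_of_pos hn0]
  rw [abs_of_pos (show (0 : ℝ) < (r : ℝ) ^ 2 by positivity)]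
  calc |∑ i ∈ Finset.range n, a i| / n
      ≤ (|∑ i ∈ Finset.range (r ^ 2), a i| + 2 * r * C) / (r : ℝ) ^ 2 := by gcongr
    _ = _ := by
      simp only [← hr]
      field_simp

/-- The strong law of large numbers for bounded, pairwise orthogonal random variables. -/
theorem ae_tendsto_sum_div_of_orthogonal [IsProbabilityMeasure μ] {D : ℕ → Ω → ℝ} {C : ℝ}
    (hm : ∀ i, Measurable (D i)) (hC : ∀ i ω, |D i ω| ≤ C)
    (horth : ∀ i j, i < j → ∫ ω, D i ω * D j ω ∂μ = 0) :
    ∀ᵐ ω ∂μ, Tendsto (fun n : ℕ => (∑ i ∈ Finset.range n, D i ω) / n) atTop (𝓝 0) := by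
  have hint : ∀ i j, Integrable (fun ω => D i ω * D j ω) μ := fun i j =>
    integrable_of_measurable_of_abs_le ((hm i).mul (hm j)) (C := C * C) fun ω => by
      rw [abs_mul]
      exact mul_le_mul (hC i ω) (hC j ω) (abs_nonneg _) ((abs_nonneg _).trans (hC i ω))
  have horth' : ∀ i j, i ≠ j → ∫ ω, D i ω * D j ω ∂μ = 0 := fun i j hij => by
    rcases hij.lt_or_gt with h | h
    · exact horth i j h
    · simpa only [mul_comm] using horth j i h
  have hsq : ∀ n : ℕ, ∫ ω, (∑ i ∈ Finset.range n, D i ω) ^ 2 ∂μ ≤ n * C ^ 2 := fun n => by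
    simp only [sq, Finset.sum_mul_sum]
    rw [integral_finsetSum _ fun i _ => integrable_finsetSum _ fun j _ => hint i j]
    have : ∀ i ∈ Finset.range n, ∫ ω, ∑ j ∈ Finset.range n, D i ω * D j ω ∂μ ≤ C * C := by
      intro i hi
      rw [integral_finsetSum _ fun j _ => hint i j, Finset.sum_eq_single_of_mem i hi
        fun j _ hj => horth' i j hj.symm]
      calc ∫ ω, D i ω * D i ω ∂μ ≤ ∫ _, C * C ∂μ := by
            refine integral_mono (hint i i) (integrable_const _) fun ω => ?_
            simp only
            rw [← abs_mul_abs_self]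
            exact mul_le_mul (hC i ω) (hC i ω) (abs_nonneg _) ((abs_nonneg _).trans (hC i ω))
        _ = C * C := by simp
    simpa using Finset.sum_le_card_nsmul _ _ _ this
  -- Second moments of the averages are of order `1 / n`, which is not summable, but along squares
  -- they are bounded by `C ^ 2 / n ^ 2`.
  have hfin : ∑' n : ℕ, ∫⁻ ω, ENNReal.ofReal
      (((∑ i ∈ Finset.range (n ^ 2), D i ω) / (n : ℝ) ^ 2) ^ 2) ∂μ ≠ ⊤ := by
    have hle : ∀ n : ℕ, ∫⁻ ω, ENNReal.ofReal
        (((∑ i ∈ Finset.range (n ^ 2), D i ω) / (n : ℝ) ^ 2) ^ 2) ∂μ ≤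
        ENNReal.ofReal (C ^ 2 * (1 / (n : ℝ) ^ 2)) := fun n => by
      have hi : Integrable (fun ω => (∑ i ∈ Finset.range (n ^ 2), D i ω) ^ 2) μ := by
        simp only [sq, Finset.sum_mul_sum]
        exact integrable_finsetSum _ fun i _ => integrable_finsetSum _ fun j _ => hint i j
      simp only [div_pow]
      rw [← ofReal_integral_eq_lintegral_ofReal (hi.div_const _)
        (ae_of_all _ fun ω => by positivity), integral_div]
      refine ENNReal.ofReal_le_ofReal ?_
      rcases Nat.eq_zero_or_pos n with rfl | hn
      · simp
      · have hn' : (0 : ℝ) < n := by exact_mod_cast hn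
        refine (div_le_div_of_nonneg_right (hsq (n ^ 2)) (by positivity)).trans (le_of_eq ?_)
        push_cast
        field_simp
    refine ne_top_of_le_ne_top ?_ (ENNReal.tsum_le_tsum hle)
    exact ((Real.summable_one_div_nat_pow.mpr one_lt_two).mul_left _).tsum_ofReal_ne_top
  have hmeas : ∀ n : ℕ, Measurable fun ω => ENNReal.ofReal
      (((∑ i ∈ Finset.range (n ^ 2), D i ω) / (n : ℝ) ^ 2) ^ 2) := fun n => by
    have := Finset.measurable_sum (Finset.range (n ^ 2)) fun i _ => hm i
    exact ((this.div_const _).pow_const 2).ennreal_ofReal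
  rw [← lintegral_tsum fun n => (hmeas n).aemeasurable] at hfin
  filter_upwards [ae_lt_top (Measurable.tsum hmeas) hfin] with ω hω
  refine tendsto_sum_div_of_tendsto_sq (fun i => hC i ω) ?_
  have h1 := ENNReal.tendsto_atTop_zero_of_tsum_ne_top hω.ne
  have h2 := (ENNReal.tendsto_toReal ENNReal.zero_ne_top).comp h1
  have h3 := h2.sqrt
  simp only [Function.comp_def, ENNReal.toReal_zero, Real.sqrt_zero,
    ENNReal.toReal_ofReal (sq_nonneg _), Real.sqrt_sq_eq_abs] at h3
  exact (tendsto_zero_iff_abs_tendsto_zero _).mpr h3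

end Orthogonal

/-! ### Conditional expectations: transport and orthogonality -/

section CondExp

/-- Conditional expectations are carried along measure preserving maps. -/
theorem condExp_comp_ae_eq {α β : Type*} {m : MeasurableSpace β} [mα : MeasurableSpace α]
    [mβ : MeasurableSpace β] {μ : Measure α} {ν : Measure β} [IsFiniteMeasure μ]
    [IsFiniteMeasure ν] {φ : α → β} (hφ : MeasurePreserving φ μ ν) (hm : m ≤ mβ) {g : β → ℝ}
    (hg : Integrable g ν) : μ[g ∘ φ|m.comap φ] =ᵐ[μ] ν[g|m] ∘ φ := by
  have hle : m.comap φ ≤ mα := (MeasurableSpace.comap_mono hm).trans hφ.measurable.comap_le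
  symm
  refine ae_eq_condExp_of_forall_setIntegral_eq hle (hφ.integrable_comp_of_integrable hg)
    (fun s _ _ => (hφ.integrable_comp_of_integrable integrable_condExp).integrableOn) ?_ ?_
  · rintro s ⟨t, ht, rfl⟩ -
    have ht' := hm _ ht
    have key : ∀ u : β → ℝ, Integrable u ν →
        ∫ x in φ ⁻¹' t, (u ∘ φ) x ∂μ = ∫ x in t, u x ∂ν := fun u hu => by
      rw [← hφ.map_eq] at hu ⊢
      exact (setIntegral_map ht' hu.aestronglyMeasurable hφ.measurable.aemeasurable).symm
    rw [key _ integrable_condExp, key _ hg, setIntegral_condExp hm hg ht]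
  · exact (stronglyMeasurable_condExp.comp_measurable
      (comap_measurable φ)).aestronglyMeasurable

theorem integral_mul_sub_condExp_eq_zero {α : Type*} {m : MeasurableSpace α}
    [mα : MeasurableSpace α] {μ : Measure α} [IsFiniteMeasure μ] (hm : m ≤ mα)
    {A g q : α → ℝ} (hA : Measurable[m] A) {C : ℝ} (hC : ∀ x, |A x| ≤ C) (hg : Integrable g μ)
    (hq : q =ᵐ[μ] μ[g|m]) : ∫ x, A x * (g x - q x) ∂μ = 0 := by
  have hAg : Integrable (fun x => A x * g x) μ :=
    hg.bdd_mul (hA.mono hm le_rfl).aestronglyMeasurable (ae_of_all _ hC)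
  have hAq : Integrable (fun x => A x * (μ[g|m]) x) μ :=
    integrable_condExp.bdd_mul (hA.mono hm le_rfl).aestronglyMeasurable (ae_of_all _ hC)
  have h1 : ∫ x, A x * (μ[g|m]) x ∂μ = ∫ x, A x * g x ∂μ := by
    rw [← integral_condExp hm (f := fun x => A x * g x)]
    refine integral_congr_ae ?_
    filter_upwards [condExp_mul_of_stronglyMeasurable_left (μ := μ) (hA.stronglyMeasurable)
      (g := g) hAg hg] with x hx
    exact hx.symm
  calc ∫ x, A x * (g x - q x) ∂μ = ∫ x, (A x * g x - A x * (μ[g|m]) x) ∂μ := by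
        refine integral_congr_ae ?_
        filter_upwards [hq] with x hx
        rw [hx, mul_sub]
    _ = 0 := by rw [integral_sub hAg hAq, h1, sub_self]

end CondExp

/-! ### Exponential weights and the doubling scheme -/

section Hedge

theorem exp_neg_le_one_sub_add_sq {u : ℝ} (hu : 0 ≤ u) : Real.exp (-u) ≤ 1 - u + u ^ 2 := by
  rcases le_total u 1 with h | h
  · have := (abs_le.mp (Real.abs_exp_sub_one_sub_id_le (x := -u)
      (by rw [abs_neg, abs_of_nonneg hu]; exact h))).2
    linarith [neg_sq u]
  · calc Real.exp (-u) ≤ 1 := Real.exp_le_one_iff.mpr (by linarith)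
      _ ≤ _ := by nlinarith

/-- The regret bound for the exponentially weighted average forecaster. -/
theorem sum_weightedAverage_le {ι : Type*} (s : Finset ι) {η : ℝ} (hη : 0 < η)
    (c : ℕ → ι → ℝ) (hc0 : ∀ t i, 0 ≤ c t i) (hc1 : ∀ t i, c t i ≤ 1) (a n : ℕ) (han : a ≤ n)
    {i₀ : ι} (hi₀ : i₀ ∈ s) :
    ∑ t ∈ Finset.Ico a n, (∑ i ∈ s, Real.exp (-η * ∑ r ∈ Finset.Ico a t, c r i) * c t i) /
        ∑ i ∈ s, Real.exp (-η * ∑ r ∈ Finset.Ico a t, c r i) ≤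
      ∑ t ∈ Finset.Ico a n, c t i₀ + Real.log s.card / η + η * ((n : ℝ) - a) := by
  set W : ℕ → ℝ := fun t => ∑ i ∈ s, Real.exp (-η * ∑ r ∈ Finset.Ico a t, c r i) with hW
  set x : ℕ → ℝ := fun t =>
    (∑ i ∈ s, Real.exp (-η * ∑ r ∈ Finset.Ico a t, c r i) * c t i) / W t with hx
  have hWpos : ∀ t, 0 < W t := fun t => Finset.sum_pos (fun i _ => Real.exp_pos _) ⟨i₀, hi₀⟩
  -- The total weight serves as potential: each round multiplies it by at most `exp (-η * x n + η ^
  -- 2)`, while it never drops below the weight of `i₀` (`hlow`). Comparing logarithms gives the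
  -- regret.
  have hup : ∀ n, a ≤ n → W n ≤ s.card *
      Real.exp (-η * ∑ t ∈ Finset.Ico a n, x t + η ^ 2 * ((n : ℝ) - a)) := by
    intro n hn
    induction n, hn using Nat.le_induction with
    | base => simp [hW]
    | succ n hn ih =>
      have hstep : W (n + 1) ≤ W n * (1 - η * x n + η ^ 2) := by
        have hxW : W n * x n =
            ∑ i ∈ s, Real.exp (-η * ∑ r ∈ Finset.Ico a n, c r i) * c n i := by
          rw [hx]; field_simp [(hWpos n).ne']
        have : W n * (1 - η * x n + η ^ 2) = ∑ i ∈ s,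
            Real.exp (-η * ∑ r ∈ Finset.Ico a n, c r i) * (1 - η * c n i + η ^ 2) := by
          calc _ = W n * (1 + η ^ 2) - η * (W n * x n) := by ring
            _ = _ := by
              rw [hxW, hW, Finset.sum_mul, Finset.mul_sum, ← Finset.sum_sub_distrib]
              exact Finset.sum_congr rfl fun i _ => by ring
        rw [this]
        refine Finset.sum_le_sum fun i _ => ?_
        rw [Finset.sum_Ico_succ_top hn, mul_add, Real.exp_add]
        gcongr
        have h1 := exp_neg_le_one_sub_add_sq (mul_nonneg hη.le (hc0 n i))
        have h2 : (η * c n i) ^ 2 ≤ η ^ 2 := by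
          rw [mul_pow]
          exact mul_le_of_le_one_right (sq_nonneg _) (pow_le_one₀ (hc0 n i) (hc1 n i))
        rw [neg_mul]
        linarith
      calc W (n + 1) ≤ W n * (1 - η * x n + η ^ 2) := hstep
        _ ≤ W n * Real.exp (-η * x n + η ^ 2) := by
          gcongr
          linarith [Real.add_one_le_exp (-η * x n + η ^ 2)]
        _ ≤ (s.card * Real.exp (-η * ∑ t ∈ Finset.Ico a n, x t + η ^ 2 * ((n : ℝ) - a))) *
            Real.exp (-η * x n + η ^ 2) := by gcongr
        _ = _ := by
          rw [mul_assoc, ← Real.exp_add, Finset.sum_Ico_succ_top hn]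
          congr 2
          push_cast
          ring
  have hcard : (0 : ℝ) < s.card := by exact_mod_cast Finset.card_pos.mpr ⟨i₀, hi₀⟩
  have hlow : Real.exp (-η * ∑ t ∈ Finset.Ico a n, c t i₀) ≤ W n :=
    Finset.single_le_sum (f := fun i => Real.exp (-η * ∑ r ∈ Finset.Ico a n, c r i))
      (fun i _ => (Real.exp_pos _).le) hi₀
  have h := Real.log_le_log (Real.exp_pos _) (hlow.trans (hup n han))
  rw [Real.log_exp, Real.log_mul hcard.ne' (Real.exp_pos _).ne', Real.log_exp] at h
  have h2 : η * ∑ t ∈ Finset.Ico a n, x t ≤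
      η * (∑ t ∈ Finset.Ico a n, c t i₀ + Real.log s.card / η + η * ((n : ℝ) - a)) := by
    rw [mul_add, mul_add, mul_div_cancel₀ _ hη.ne']
    linarith
  exact le_of_mul_le_mul_left h2 hη

/-- Bounds on dyadic blocks add up. -/
theorem sum_Ico_one_le_sum_dyadic {D : ℕ → ℝ} {e : ℕ → ℝ}
    (h : ∀ m n, 2 ^ m ≤ n → n ≤ 2 ^ (m + 1) → ∑ i ∈ Finset.Ico (2 ^ m) n, D i ≤ e m) {n : ℕ}
    (hn : 1 ≤ n) :
    ∑ i ∈ Finset.Ico 1 (n + 1), D i ≤ ∑ j ∈ Finset.range (Nat.log 2 n + 1), e j := by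
  have key : ∀ m, ∑ i ∈ Finset.Ico 1 (2 ^ m), D i ≤ ∑ j ∈ Finset.range m, e j := by
    intro m
    induction m with
    | zero => simp
    | succ m ih =>
      rw [Finset.sum_range_succ, ← Finset.sum_Ico_consecutive _ (Nat.one_le_two_pow (n := m))
        (Nat.pow_le_pow_right two_pos m.le_succ)]
      exact add_le_add ih (h m _ (Nat.pow_le_pow_right two_pos m.le_succ) le_rfl)
  have h1 : 2 ^ Nat.log 2 n ≤ n := Nat.pow_log_le_self 2 (by omega)
  have h2 : n < 2 ^ (Nat.log 2 n + 1) := Nat.lt_pow_succ_log_self one_lt_two n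
  rw [Finset.sum_range_succ, ← Finset.sum_Ico_consecutive _ (Nat.one_le_two_pow)
    (h1.trans n.le_succ)]
  exact add_le_add (key _) (h _ _ (h1.trans n.le_succ) h2)

/-- Block errors that are `o(2 ^ m)` sum to `o` of the geometric sum, and that sum is at most `2 *
n`. -/
theorem tendsto_sum_dyadic_div {e : ℕ → ℝ}
    (he : Tendsto (fun m : ℕ => e m / 2 ^ m) atTop (𝓝 0)) :
    Tendsto (fun n : ℕ => (∑ j ∈ Finset.range (Nat.log 2 n + 1), e j) / n) atTop (𝓝 0) := by
  have h1 : e =o[atTop] fun m : ℕ => (2 : ℝ) ^ m :=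
    (Asymptotics.isLittleO_iff_tendsto fun m hm => absurd hm (by positivity)).mpr he
  have hgeom : ∀ n : ℕ, ∑ j ∈ Finset.range n, (2 : ℝ) ^ j = 2 ^ n - 1 := fun n => by
    rw [geom_sum_eq (by norm_num)]; norm_num
  have h2 := h1.sum_range (fun _ => by positivity) (by
    simp only [hgeom]
    exact tendsto_atTop_add_const_right _ _ (tendsto_pow_atTop_atTop_of_one_lt one_lt_two))
  have hlog : Tendsto (fun n => Nat.log 2 n + 1) atTop atTop :=
    tendsto_atTop.mpr fun b => by
      filter_upwards [eventually_ge_atTop (2 ^ b)] with n hn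
      exact (Nat.le_log_of_pow_le one_lt_two hn).trans (Nat.le_succ _)
  have h3 := h2.comp_tendsto hlog
  refine Asymptotics.IsLittleO.tendsto_div_nhds_zero (h3.trans_isBigO ?_)
  refine Asymptotics.IsBigO.of_bound 2 ?_
  filter_upwards [eventually_ge_atTop 1] with n hn
  have h4 : (2 : ℝ) ^ Nat.log 2 n ≤ n := by exact_mod_cast Nat.pow_log_le_self 2 (by omega)
  have h5 : (1 : ℝ) ≤ 2 ^ (Nat.log 2 n + 1) := one_le_pow₀ one_le_two
  simp only [Function.comp, hgeom, Real.norm_eq_abs, Nat.abs_cast]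
  rw [abs_of_nonneg (by linarith), pow_succ]
  linarith

theorem learningRate_pos (m : ℕ) : 0 < learningRate m := by
  refine Real.sqrt_pos.mpr (div_pos (mul_pos (by norm_num) (Real.log_pos ?_)) (by positivity))
  exact one_lt_pow₀ (one_lt_pow₀ one_lt_two (Nat.succ_ne_zero m)) two_ne_zero

theorem tendsto_learningRate : Tendsto learningRate atTop (𝓝 0) := by
  have h : Tendsto (fun m : ℕ => 8 * Real.log (((2 : ℝ) ^ (m + 1)) ^ 2) / 2 ^ m) atTop (𝓝 0) := by
    have h1 : Tendsto (fun m : ℕ => (m : ℝ) * (1 / 2) ^ m) atTop (𝓝 0) :=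
      tendsto_self_mul_const_pow_of_lt_one (by norm_num) (by norm_num)
    have h2 : Tendsto (fun m : ℕ => (1 / 2 : ℝ) ^ m) atTop (𝓝 0) :=
      tendsto_pow_atTop_nhds_zero_of_lt_one (by norm_num) (by norm_num)
    have h3 := (h1.add h2).const_mul (16 * Real.log 2)
    simp only [add_zero, mul_zero] at h3
    refine h3.congr fun m => ?_
    rw [← pow_mul, Real.log_pow, one_div, inv_pow]
    push_cast
    field_simp
    ring
  have := h.sqrt
  rwa [Real.sqrt_zero] at this

/-- This balances the two regret terms: on a block of length `2 ^ m` both become multiples of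
`learningRate m * 2 ^ m`, which is `o(2 ^ m)`. -/
theorem log_div_learningRate (m : ℕ) :
    Real.log (((2 : ℝ) ^ (m + 1)) ^ 2) / learningRate m = learningRate m * 2 ^ m / 8 := by
  have h1 : learningRate m ^ 2 = 8 * Real.log (((2 : ℝ) ^ (m + 1)) ^ 2) / 2 ^ m := by
    refine Real.sq_sqrt (div_nonneg (mul_nonneg (by norm_num) (Real.log_nonneg ?_))
      (by positivity))
    exact one_le_pow₀ (one_le_pow₀ one_le_two)
  have h2 := learningRate_pos m
  rw [eq_div_iff (by positivity)] at h1
  rw [div_eq_iff h2.ne']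
  linarith

end Hedge

end PatternPrediction

noncomputable section

namespace PatternPrediction

/-! ### Time averages and Cesàro limits -/

section TimeAverage

/-- The average of a sequence over the times `1, …, n`. -/
def timeAvg (F : ℕ → ℝ) (n : ℕ) : ℝ := (∑ i ∈ Finset.Icc 1 n, F i) / n

theorem timeAvg_eq_range (F : ℕ → ℝ) (n : ℕ) :
    timeAvg F n = (∑ i ∈ Finset.range n, F (i + 1)) / n := by
  rw [timeAvg, Finset.range_eq_Ico, Finset.sum_Ico_add' F 0 n 1]
  rfl

theorem timeAvg_add (F G : ℕ → ℝ) (n : ℕ) :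
    timeAvg (fun i => F i + G i) n = timeAvg F n + timeAvg G n := by
  simp only [timeAvg, Finset.sum_add_distrib, add_div]

theorem timeAvg_const_mul (c : ℝ) (F : ℕ → ℝ) (n : ℕ) :
    timeAvg (fun i => c * F i) n = c * timeAvg F n := by
  simp only [timeAvg, ← Finset.mul_sum, mul_div_assoc]

theorem timeAvg_mono {F G : ℕ → ℝ} (h : ∀ i, 1 ≤ i → F i ≤ G i) (n : ℕ) :
    timeAvg F n ≤ timeAvg G n := by
  unfold timeAvg
  gcongr with i hi
  exact h i (Finset.mem_Icc.mp hi).1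

theorem tendsto_timeAvg {F : ℕ → ℝ} {a : ℝ} (h : Tendsto F atTop (𝓝 a)) :
    Tendsto (timeAvg F) atTop (𝓝 a) := by
  have := ((tendsto_add_atTop_iff_nat 1).mpr h).cesaro
  refine this.congr fun n => ?_
  rw [timeAvg_eq_range, div_eq_inv_mul]

theorem tendsto_sum_Ioo_div {F : ℕ → ℝ} {a C : ℝ} (hC : ∀ i, |F i| ≤ C)
    (h : Tendsto (timeAvg F) atTop (𝓝 a)) (k : ℕ) :
    Tendsto (fun n : ℕ => (∑ i ∈ Finset.Ioo k n, F i) / n) atTop (𝓝 a) := by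
  have h1 : Tendsto (fun n : ℕ => F n / n) atTop (𝓝 0) := by
    refine squeeze_zero_norm (fun n => ?_) (tendsto_const_div_atTop_nhds_zero_nat C)
    rw [norm_div, Real.norm_natCast]
    gcongr
    exact hC n
  have h2 := tendsto_const_div_atTop_nhds_zero_nat (∑ i ∈ Finset.Icc 1 k, F i)
  have h3 := (h.sub h1).sub h2
  simp only [sub_zero] at h3
  refine h3.congr' ?_
  filter_upwards [eventually_gt_atTop k] with n hn
  rw [timeAvg, ← sub_div, ← sub_div]
  congr 1
  have e1 : Finset.Icc 1 n = Finset.Ico 1 (n + 1) := rfl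
  have e2 : Finset.Icc 1 k = Finset.Ico 1 (k + 1) := rfl
  have e3 : Finset.Ioo k n = Finset.Ico (k + 1) n := rfl
  rw [e1, e2, e3, Finset.sum_Ico_succ_top (by omega),
    ← Finset.sum_Ico_consecutive F (show 1 ≤ k + 1 by omega) (show k + 1 ≤ n by omega)]
  ring

end TimeAverage

/-! ### The trajectory space, the past and the posterior -/

section Canonical

variable {E : Type*}

/-- Translation of a two-sided sequence by `j`. -/
def translate {α : Type*} (j : ℤ) (z : ℤ → α) : ℤ → α := fun n => z (n + j)

theorem shift_iterate {α : Type*} (n : ℕ) (z : ℤ → α) : shift^[n] z = translate n z := by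
  induction n generalizing z with
  | zero => funext m; simp [translate]
  | succ n ih =>
    rw [Function.iterate_succ_apply, ih]
    funext m
    simp only [translate, shift]
    congr 1
    push_cast
    ring

/-- A bit as a real number. -/
def bit (b : Fin 2) : ℝ := ((b : ℕ) : ℝ)

@[simp] theorem bit_zero : bit 0 = 0 := by simp [bit]

@[simp] theorem bit_one : bit 1 = 1 := by simp [bit]

theorem bit_eq_zero_or_one (b : Fin 2) : bit b = 0 ∨ bit b = 1 := by
  fin_cases b <;> simp

theorem bit_nonneg (b : Fin 2) : 0 ≤ bit b := Nat.cast_nonneg _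

theorem bit_le_one (b : Fin 2) : bit b ≤ 1 := by
  rcases bit_eq_zero_or_one b with h | h <;> simp [h]

theorem ite_ne_eq_bit (a b : Fin 2) :
    (if a ≠ b then (1 : ℝ) else 0) = bit a + bit b - 2 * bit a * bit b := by
  fin_cases a <;> fin_cases b <;> norm_num

variable [MeasurableSpace E]

/-- The σ-algebra, on the space of trajectories, of the outcomes before time `0` and of the side
information up to time `0`. -/
abbrev pastCoord (E : Type*) [MeasurableSpace E] : MeasurableSpace (ℤ → E × Fin 2) :=
  pastSigma (fun n z => (z n).1) (fun n z => (z n).2)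

/-- The σ-algebra of the outcomes before time `i` and of the side information up to time `i`. -/
abbrev pastAt (E : Type*) [MeasurableSpace E] (i : ℤ) : MeasurableSpace (ℤ → E × Fin 2) :=
  (pastCoord E).comap (translate i)

theorem pastCoord_le_iff {m : MeasurableSpace (ℤ → E × Fin 2)} :
    pastCoord E ≤ m ↔ (∀ n ≤ (-1 : ℤ), Measurable[m] fun z : ℤ → E × Fin 2 => (z n).2) ∧
      ∀ n ≤ (0 : ℤ), Measurable[m] fun z : ℤ → E × Fin 2 => (z n).1 := by
  simp only [sup_le_iff, iSup_le_iff, measurable_iff_comap_le]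

theorem pastAt_le_iff {m : MeasurableSpace (ℤ → E × Fin 2)} {i : ℤ} :
    pastAt E i ≤ m ↔ (∀ n < i, Measurable[m] fun z : ℤ → E × Fin 2 => (z n).2) ∧
      ∀ n ≤ i, Measurable[m] fun z : ℤ → E × Fin 2 => (z n).1 := by
  rw [pastAt, MeasurableSpace.comap_le_iff_le_map, pastCoord_le_iff]
  constructor
  · rintro ⟨h1, h2⟩
    refine ⟨fun n hn => ?_, fun n hn => ?_⟩
    · have h : Measurable[m] fun z => (translate i z (n - i)).2 := h1 (n - i) (by omega)
      simpa [translate] using h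
    · have h : Measurable[m] fun z => (translate i z (n - i)).1 := h2 (n - i) (by omega)
      simpa [translate] using h
  · rintro ⟨h1, h2⟩
    exact ⟨fun n hn => h1 (n + i) (by omega), fun n hn => h2 (n + i) (by omega)⟩

theorem measurable_snd_pastAt {n i : ℤ} (h : n < i) :
    Measurable[pastAt E i] fun z : ℤ → E × Fin 2 => (z n).2 :=
  (pastAt_le_iff.mp le_rfl).1 n h

theorem measurable_fst_pastAt {n i : ℤ} (h : n ≤ i) :
    Measurable[pastAt E i] fun z : ℤ → E × Fin 2 => (z n).1 :=
  (pastAt_le_iff.mp le_rfl).2 n h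

theorem measurable_coord_snd (n : ℤ) : Measurable fun z : ℤ → E × Fin 2 => (z n).2 :=
  (measurable_pi_apply n).snd

theorem measurable_coord_fst (n : ℤ) : Measurable fun z : ℤ → E × Fin 2 => (z n).1 :=
  (measurable_pi_apply n).fst

theorem pastCoord_le : pastCoord E ≤ MeasurableSpace.pi :=
  pastCoord_le_iff.mpr ⟨fun n _ => measurable_coord_snd n, fun n _ => measurable_coord_fst n⟩

theorem pastAt_le (i : ℤ) : pastAt E i ≤ MeasurableSpace.pi :=
  pastAt_le_iff.mpr ⟨fun n _ => measurable_coord_snd n, fun n _ => measurable_coord_fst n⟩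

theorem pastAt_mono {i j : ℤ} (h : i ≤ j) : pastAt E i ≤ pastAt E j :=
  pastAt_le_iff.mpr ⟨fun _ hn => measurable_snd_pastAt (hn.trans_le h),
    fun _ hn => measurable_fst_pastAt (hn.trans h)⟩

theorem measurable_bit : Measurable bit := measurable_of_finite _

variable {ν : Measure (ℤ → E × Fin 2)}

theorem measurePreserving_translate (hν : Ergodic shift ν) (n : ℕ) :
    MeasurePreserving (translate (n : ℤ)) ν ν := by
  have h := hν.toMeasurePreserving.iterate n
  rwa [show shift^[n] = translate (n : ℤ) from funext (shift_iterate n)] at h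

/-- A `[0, 1]`-valued version of the conditional probability that the outcome at time `0` is `1`,
given the outcomes before time `0` and the side information up to time `0`. -/
def posterior (ν : Measure (ℤ → E × Fin 2)) (z : ℤ → E × Fin 2) : ℝ :=
  max 0 (min 1 ((ν[fun z => bit (z 0).2|pastCoord E]) z))

theorem posterior_nonneg (z : ℤ → E × Fin 2) : 0 ≤ posterior ν z := le_max_left _ _

theorem posterior_le_one (z : ℤ → E × Fin 2) : posterior ν z ≤ 1 :=
  max_le zero_le_one (min_le_left _ _)

theorem measurable_posterior_pastCoord : Measurable[pastCoord E] (posterior ν) :=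
  measurable_const.max (measurable_const.min stronglyMeasurable_condExp.measurable)

theorem measurable_posterior : Measurable (posterior ν) :=
  measurable_posterior_pastCoord.mono pastCoord_le le_rfl

theorem measurable_posterior_translate (i : ℤ) :
    Measurable[pastAt E i] fun z => posterior ν (translate i z) :=
  measurable_posterior_pastCoord.comp (comap_measurable _)

variable [IsProbabilityMeasure ν]

/-- The pointwise ergodic theorem for averages over the times `1, …, n`. -/
theorem ae_tendsto_timeAvg (hν : Ergodic shift ν) {g : (ℤ → E × Fin 2) → ℝ} (hg : Measurable g)
    {C : ℝ} (hC : ∀ z, |g z| ≤ C) :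
    ∀ᵐ z ∂ν, Tendsto (timeAvg fun i => g (translate i z)) atTop (𝓝 (∫ z, g z ∂ν)) := by
  have hm := hν.toMeasurePreserving.measurable
  -- Birkhoff sums run over times `0, …, n - 1`; composing with one shift moves them to `1, …, n`
  -- without changing the integral.
  filter_upwards [ae_tendsto_birkhoffSum_div hν (hg.comp hm) (fun z => hC (shift z))] with z hz
  have hint : ∫ z, (g ∘ shift) z ∂ν = ∫ z, g z ∂ν := by
    conv_rhs => rw [← hν.toMeasurePreserving.map_eq]
    rw [integral_map hm.aemeasurable hg.aestronglyMeasurable]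
    rfl
  rw [hint] at hz
  refine hz.congr fun n => ?_
  rw [timeAvg_eq_range]
  congr 1
  refine Finset.sum_congr rfl fun i _ => ?_
  simp only [Function.comp]
  rw [← Function.iterate_succ_apply' (f := shift), shift_iterate]

theorem integrable_bit_snd (n : ℤ) : Integrable (fun z => bit (z n).2) ν :=
  integrable_of_measurable_of_abs_le (measurable_bit.comp (measurable_coord_snd n)) (C := 1)
    fun z => by rw [abs_of_nonneg (bit_nonneg _)]; exact bit_le_one _

theorem posterior_ae_eq :
    posterior ν =ᵐ[ν] ν[fun z => bit (z 0).2|pastCoord E] := by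
  have h0 : 0 ≤ᵐ[ν] ν[fun z => bit (z 0).2|pastCoord E] :=
    condExp_nonneg (ae_of_all _ fun z => bit_nonneg _)
  have h1 : ν[fun z => bit (z 0).2|pastCoord E] ≤ᵐ[ν] ν[fun _ => (1 : ℝ)|pastCoord E] :=
    condExp_mono (integrable_bit_snd 0) (integrable_const _) (ae_of_all _ fun z => bit_le_one _)
  rw [condExp_const pastCoord_le] at h1
  filter_upwards [h0, h1] with z h0 h1
  rw [posterior, min_eq_right h1]
  exact max_eq_right h0

/-- Stationarity: translation preserves the law, so it carries the conditional expectation at time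
`0` to the one at time `n`. -/
theorem posterior_translate_ae_eq (hν : Ergodic shift ν) (n : ℕ) :
    (fun z => posterior ν (translate n z)) =ᵐ[ν] ν[fun z => bit (z n).2|pastAt E n] := by
  have hφ := measurePreserving_translate hν n
  have h1 := condExp_comp_ae_eq hφ pastCoord_le (integrable_bit_snd (ν := ν) 0)
  have h2 : (fun z : ℤ → E × Fin 2 => bit (z 0).2) ∘ translate (n : ℤ) =
      fun z => bit (z n).2 := by
    funext z; simp [translate]
  rw [h2] at h1
  exact (hφ.quasiMeasurePreserving.ae_eq_comp posterior_ae_eq).trans h1.symm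

/-- The law of large numbers for the prediction errors, weighted by nonanticipating factors. -/
theorem ae_tendsto_timeAvg_mul_sub_posterior (hν : Ergodic shift ν)
    {p : ℕ → (ℤ → E × Fin 2) → ℝ} (hp : ∀ i : ℕ, Measurable[pastAt E i] (p i))
    (hp1 : ∀ i z, |p i z| ≤ 1) :
    ∀ᵐ z ∂ν, Tendsto
      (timeAvg fun i => p i z * (bit (z i).2 - posterior ν (translate i z))) atTop (𝓝 0) := by
  have hb : ∀ (i : ℕ) (z : ℤ → E × Fin 2), |bit (z i).2 - posterior ν (translate i z)| ≤ 1 :=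
    fun i z => by
      rw [abs_le]
      constructor <;> linarith [bit_nonneg (z i).2, bit_le_one (z i).2,
        posterior_nonneg (ν := ν) (translate i z), posterior_le_one (ν := ν) (translate i z)]
  have hD : ∀ (i : ℕ) (z : ℤ → E × Fin 2),
      |p i z * (bit (z i).2 - posterior ν (translate i z))| ≤ 1 := fun i z => by
    rw [abs_mul]
    exact mul_le_one₀ (hp1 i z) (abs_nonneg _) (hb i z)
  have hDm : ∀ i j : ℕ, i < j → Measurable[pastAt E j]
      fun z => p i z * (bit (z i).2 - posterior ν (translate i z)) := fun i j hij => by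
    have hle : pastAt E (i : ℤ) ≤ pastAt E (j : ℤ) := pastAt_mono (by exact_mod_cast hij.le)
    exact ((hp i).mono hle le_rfl).mul ((measurable_bit.comp
      (measurable_snd_pastAt (by exact_mod_cast hij))).sub
      ((measurable_posterior_translate _).mono hle le_rfl))
  have key := ae_tendsto_sum_div_of_orthogonal (μ := ν) (C := 1)
    (D := fun i z => p (i + 1) z *
      (bit (z ((i + 1 : ℕ) : ℤ)).2 - posterior ν (translate ((i + 1 : ℕ) : ℤ) z)))
    (fun i => (hDm (i + 1) (i + 2) (by omega)).mono (pastAt_le _) le_rfl)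
    (fun i z => hD (i + 1) z) ?_
  · filter_upwards [key] with z hz
    refine hz.congr fun n => ?_
    rw [timeAvg_eq_range]
  · intro i j hij
    -- The earlier error, times the later factor `p (j + 1)`, is known at time `j + 1`, hence
    -- orthogonal to the centered outcome there.
    have h := integral_mul_sub_condExp_eq_zero (pastAt_le ((j + 1 : ℕ) : ℤ))
      (((hDm (i + 1) (j + 1) (by omega))).mul (hp (j + 1))) (C := 1)
      (fun z => by
        simp only [Pi.mul_apply]
        rw [abs_mul]
        exact mul_le_one₀ (hD _ z) (abs_nonneg _) (hp1 _ z))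
      (integrable_bit_snd _) (posterior_translate_ae_eq hν (j + 1))
    simpa only [Pi.mul_apply, mul_assoc] using h

end Canonical

/-! ### Consistency of a single expert -/

section Experts

variable {E : Type*}

/-- The outcomes at the nonnegative times of a trajectory. -/
abbrev outcomes (z : ℤ → E × Fin 2) : ℕ → Fin 2 := fun i => (z i).2

/-- The side information at the nonnegative times of a trajectory. -/
abbrev sideInfo (z : ℤ → E × Fin 2) : ℕ → E := fun i => (z i).1

/-- The quantized context of order `k` at time `0`. -/
def context (P : FinitePartition E) (k : ℕ) (z : ℤ → E × Fin 2) :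
    (Fin k → Fin 2) × (Fin (k + 1) → Fin P.size) :=
  (fun j => (z (((j : ℕ) : ℤ) - k)).2, fun j => P.quantizer (z (((j : ℕ) : ℤ) - k)).1)

/-- The bound `k ≤ i` keeps the natural subtraction `i - k` from truncating. -/
theorem context_translate (P : FinitePartition E) {k i : ℕ} (h : k ≤ i) (z : ℤ → E × Fin 2) :
    context P k (translate i z) = (block (outcomes z) (i - k) k,
      block (fun t => P.quantizer (sideInfo z t)) (i - k) (k + 1)) := by
  have key : ∀ j : ℕ, (j : ℤ) - k + i = ((i - k + j : ℕ) : ℤ) := fun j => by omega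
  simp only [context, translate, key]
  rfl

theorem matchTimes_eq_filter (P : FinitePartition E) (k n : ℕ) (z : ℤ → E × Fin 2)
    (c : (Fin k → Fin 2) × (Fin (k + 1) → Fin P.size)) :
    matchTimes P k n (outcomes z) (sideInfo z) c.1 c.2 =
      (Finset.Ioo k n).filter fun i : ℕ => context P k (translate (i : ℤ) z) = c := by
  refine Finset.filter_congr fun i hi => ?_
  rw [context_translate P (Finset.mem_Ioo.mp hi).1.le, Prod.ext_iff]

/-- The relative frequency of `1` after the earlier occurrences of the context seen at time `n`. -/
def estimate (P : FinitePartition E) (k n : ℕ) (z : ℤ → E × Fin 2) : ℝ :=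
  1 - empFreq P k n 0 (outcomes z) (sideInfo z) (block (outcomes z) (n - k) k)
    (block (fun t => P.quantizer (sideInfo z t)) (n - k) (k + 1))

/-- The plug-in bound: a decision differing from the Bayes one costs an extra `|1 - 2 * f|`, and it
can differ only if `1 / 2` lies between the estimate and `f`. -/
theorem expert_risk_le (P : FinitePartition E) (k n : ℕ) (z : ℤ → E × Fin 2) {f : ℝ} :
    bit (expert P k n (outcomes z) (sideInfo z)) + f -
        2 * bit (expert P k n (outcomes z) (sideInfo z)) * f ≤
      min f (1 - f) + 2 * |estimate P k n z - f| := by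
  have h1 := neg_abs_le (estimate P k n z - f)
  have h2 := le_abs_self (estimate P k n z - f)
  unfold expert
  unfold estimate at h1 h2 ⊢
  split_ifs with h <;> rcases min_cases f (1 - f) with ⟨h3, h4⟩ | ⟨h3, h4⟩ <;>
    simp only [bit_zero, bit_one] <;> rw [h3] <;> linarith

theorem measurable_context_iff [MeasurableSpace E] {P : FinitePartition E} {k : ℕ}
    {m : MeasurableSpace (ℤ → E × Fin 2)} :
    Measurable[m] (context P k) ↔
      (∀ j : Fin k, Measurable[m] fun z : ℤ → E × Fin 2 => (z (((j : ℕ) : ℤ) - k)).2) ∧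
      ∀ j : Fin (k + 1), Measurable[m] fun z : ℤ → E × Fin 2 =>
        P.quantizer (z (((j : ℕ) : ℤ) - k)).1 := by
  constructor
  · intro h
    exact ⟨fun j => (measurable_pi_apply j).comp (measurable_fst.comp h),
      fun j => (measurable_pi_apply j).comp (measurable_snd.comp h)⟩
  · rintro ⟨h1, h2⟩
    exact (measurable_pi_lambda _ h1).prodMk (measurable_pi_lambda _ h2)

variable [MeasurableSpace E] {P : FinitePartition E} {k : ℕ}

theorem measurable_quantizer (hP : ∀ j, MeasurableSet (P.cell j)) : Measurable P.quantizer := by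
  refine measurable_to_countable' fun j => ?_
  convert hP j using 1
  ext x
  exact P.quantizer_eq_iff x j

theorem measurable_context_pastCoord (hP : ∀ j, MeasurableSet (P.cell j)) :
    Measurable[pastCoord E] (context P k) := by
  have h := pastCoord_le_iff.mp (le_refl (pastCoord E))
  exact measurable_context_iff.mpr ⟨fun j => h.1 _ (by omega),
    fun j => (measurable_quantizer hP).comp (h.2 _ (by omega))⟩

theorem measurable_context (hP : ∀ j, MeasurableSet (P.cell j)) : Measurable (context P k) :=
  (measurable_context_pastCoord hP).mono pastCoord_le le_rfl

/-- The conditional probability that the outcome at time `0` is `1`, given the quantized context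
of order `k`. -/
def contextPosterior (ν : Measure (ℤ → E × Fin 2)) (P : FinitePartition E) (k : ℕ) :
    (ℤ → E × Fin 2) → ℝ :=
  ν[fun z => bit (z 0).2|MeasurableSpace.comap (context P k) inferInstance]

variable {ν : Measure (ℤ → E × Fin 2)}

/-- Measurability with respect to the context forces factorization through it. As contexts are
finite in number, the posterior takes finitely many values, hence is bounded, and convergence may be
checked one context at a time. -/
theorem exists_contextPosterior_eq (ν : Measure (ℤ → E × Fin 2)) (P : FinitePartition E) (k : ℕ) :
    ∃ q : (Fin k → Fin 2) × (Fin (k + 1) → Fin P.size) → ℝ,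
      ∀ z, contextPosterior ν P k z = q (context P k z) := by
  have h : Function.FactorsThrough (contextPosterior ν P k) (context P k) :=
    (stronglyMeasurable_condExp (m := MeasurableSpace.comap (context P k)
      inferInstance)).measurable.factorsThrough
  exact ⟨Function.extend (context P k) (contextPosterior ν P k) 0, fun z =>
    (h.extend_apply _ z).symm⟩

theorem exists_abs_contextPosterior_le (ν : Measure (ℤ → E × Fin 2)) (P : FinitePartition E)
    (k : ℕ) : ∃ C, ∀ z, |contextPosterior ν P k z| ≤ C := by
  obtain ⟨q, hq⟩ := exists_contextPosterior_eq ν P k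
  obtain ⟨C, hC⟩ := (Set.finite_range fun c => |q c|).bddAbove
  exact ⟨C, fun z => by rw [hq]; exact hC ⟨_, rfl⟩⟩

theorem measurable_contextPosterior (hP : ∀ j, MeasurableSet (P.cell j)) :
    Measurable (contextPosterior ν P k) :=
  stronglyMeasurable_condExp.measurable.mono (measurable_context hP).comap_le le_rfl

variable [IsProbabilityMeasure ν]

theorem integral_indicator_context_mul (hP : ∀ j, MeasurableSet (P.cell j))
    {q : (Fin k → Fin 2) × (Fin (k + 1) → Fin P.size) → ℝ}
    (hq : ∀ z, contextPosterior ν P k z = q (context P k z))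
    (c : (Fin k → Fin 2) × (Fin (k + 1) → Fin P.size)) :
    ∫ z, (if context P k z = c then 1 - bit (z 0).2 else 0) ∂ν =
      (1 - q c) * ν.real (context P k ⁻¹' {c}) := by
  have hm := measurable_context (k := k) hP
  have h := integral_mul_sub_condExp_eq_zero (μ := ν) hm.comap_le
    (A := fun z => if context P k z = c then 1 else 0) (C := 1)
    (g := fun z => bit (z 0).2) (q := contextPosterior ν P k)
    (Measurable.ite (comap_measurable _ (measurableSet_singleton c)) measurable_const
      measurable_const) (fun z => by split_ifs <;> simp) (integrable_bit_snd 0)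
    (ae_eq_refl _)
  have h1 : ∫ z, (context P k ⁻¹' {c}).indicator (fun _ => 1 - q c) z ∂ν =
      (1 - q c) * ν.real (context P k ⁻¹' {c}) := by
    rw [integral_indicator_const _ (hm (measurableSet_singleton c)), smul_eq_mul, mul_comm]
  have h2 : Integrable (fun z => (if context P k z = c then (1 : ℝ) else 0) *
      (bit (z 0).2 - contextPosterior ν P k z)) ν :=
    ((integrable_bit_snd 0).sub integrable_condExp).bdd_mul (c := 1)
      (Measurable.ite (hm (measurableSet_singleton c)) measurable_const
        measurable_const).aestronglyMeasurable (ae_of_all _ fun z => by split_ifs <;> simp)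
  have h3 := integral_sub ((integrable_const (μ := ν) (1 - q c)).indicator
    (hm (measurableSet_singleton c))) h2
  rw [h, sub_zero, h1] at h3
  rw [← h3]
  refine integral_congr_ae (ae_of_all _ fun z => ?_)
  by_cases hz : context P k z = c
  · simp [hz, hq]
  · simp [hz]

/-- Numerator and denominator, each divided by `n`, converge by the ergodic theorem, the latter to
the positive probability of `c`. So the default `1 / 2` is eventually not in force. -/
theorem ae_tendsto_empFreq (hν : Ergodic shift ν) (hP : ∀ j, MeasurableSet (P.cell j))
    {q : (Fin k → Fin 2) × (Fin (k + 1) → Fin P.size) → ℝ}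
    (hq : ∀ z, contextPosterior ν P k z = q (context P k z))
    (c : (Fin k → Fin 2) × (Fin (k + 1) → Fin P.size)) (hc : ν (context P k ⁻¹' {c}) ≠ 0) :
    ∀ᵐ z ∂ν, Tendsto (fun n => 1 - empFreq P k n 0 (outcomes z) (sideInfo z) c.1 c.2) atTop
      (𝓝 (q c)) := by
  have hms : MeasurableSet {z | context P k z = c} :=
    measurable_context hP (measurableSet_singleton c)
  have hm0 : Measurable fun z : ℤ → E × Fin 2 => bit (z 0).2 :=
    measurable_bit.comp (measurable_coord_snd 0)
  have hb1 : ∀ z : ℤ → E × Fin 2, |if context P k z = c then (1 : ℝ) else 0| ≤ 1 := fun z => by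
    split_ifs <;> simp
  have hb2 : ∀ z : ℤ → E × Fin 2, |if context P k z = c then 1 - bit (z 0).2 else 0| ≤ 1 :=
    fun z => by
      split_ifs
      · rw [abs_le]; constructor <;> linarith [bit_nonneg (z 0).2, bit_le_one (z 0).2]
      · simp
  have h1 : ∫ z, (if context P k z = c then (1 : ℝ) else 0) ∂ν =
      ν.real (context P k ⁻¹' {c}) := by
    rw [← integral_indicator_one (measurable_context hP (measurableSet_singleton c))]
    refine integral_congr_ae (ae_of_all _ fun z => ?_)
    by_cases hz : context P k z = c
    · simp only [if_pos hz]
      rw [Set.indicator_of_mem (by exact hz), Pi.one_apply]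
    · simp only [if_neg hz]
      rw [Set.indicator_of_notMem (by exact hz)]
  have hpos : ν.real (context P k ⁻¹' {c}) ≠ 0 := by
    rw [Measure.real, ENNReal.toReal_ne_zero]
    exact ⟨hc, measure_ne_top _ _⟩
  filter_upwards [ae_tendsto_timeAvg hν (Measurable.ite hms measurable_const measurable_const) hb1,
    ae_tendsto_timeAvg hν (g := fun z => if context P k z = c then 1 - bit (z 0).2 else 0)
      (Measurable.ite hms (measurable_const.sub hm0) measurable_const) hb2]
    with z hz1 hz2
  rw [h1] at hz1
  rw [integral_indicator_context_mul hP hq c] at hz2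
  have hz1' := tendsto_sum_Ioo_div (fun i => hb1 _) hz1 k
  have hz2' := tendsto_sum_Ioo_div (fun i => hb2 _) hz2 k
  have hdiv := (tendsto_const_nhds (x := (1 : ℝ))).sub (hz2'.div hz1' hpos)
  rw [mul_div_cancel_right₀ _ hpos, sub_sub_cancel] at hdiv
  refine hdiv.congr' ?_
  filter_upwards [eventually_gt_atTop (k + 1), hz1'.eventually_ne hpos] with n hn hn0
  have hcard : ∑ i ∈ Finset.Ioo k n,
      (if context P k (translate (i : ℤ) z) = c then (1 : ℝ) else 0) =
      (matchTimes P k n (outcomes z) (sideInfo z) c.1 c.2).card := by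
    rw [matchTimes_eq_filter, Finset.sum_boole]
  have hcard0 : ∑ i ∈ Finset.Ioo k n, (if context P k (translate (i : ℤ) z) = c then
      1 - bit (translate (i : ℤ) z 0).2 else 0) =
      ((matchTimes P k n (outcomes z) (sideInfo z) c.1 c.2).filter
        fun i => outcomes z i = 0).card := by
    rw [matchTimes_eq_filter, Finset.filter_filter, ← Finset.sum_boole]
    refine Finset.sum_congr rfl fun i _ => ?_
    by_cases hi : context P k (translate (i : ℤ) z) = c
    · simp only [hi, if_true, true_and, translate, zero_add, outcomes]
      generalize (z (i : ℤ)).2 = b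
      fin_cases b <;> simp
    · simp [hi]
  rw [hcard] at hn0
  have hne : (matchTimes P k n (outcomes z) (sideInfo z) c.1 c.2).card ≠ 0 := by
    intro h0
    rw [h0] at hn0
    simp at hn0
  have hn' : (n : ℝ) ≠ 0 := by
    have : 0 < n := by omega
    exact_mod_cast this.ne'
  rw [empFreq, if_neg (by push Not; exact ⟨hn, hne⟩), Pi.div_apply, div_div_div_cancel_right₀ hn',
    hcard, hcard0]

theorem ae_tendsto_estimate_sub (hν : Ergodic shift ν) (hP : ∀ j, MeasurableSet (P.cell j)) :
    ∀ᵐ z ∂ν, Tendsto (fun n : ℕ => estimate P k n z - contextPosterior ν P k (translate n z))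
      atTop (𝓝 0) := by
  obtain ⟨q, hq⟩ := exists_contextPosterior_eq ν P k
  have hfreq : ∀ᵐ z ∂ν, ∀ c, ν (context P k ⁻¹' {c}) ≠ 0 →
      Tendsto (fun n => 1 - empFreq P k n 0 (outcomes z) (sideInfo z) c.1 c.2) atTop
        (𝓝 (q c)) := by
    refine ae_all_iff.mpr fun c => ?_
    by_cases hc : ν (context P k ⁻¹' {c}) = 0
    · exact ae_of_all _ fun z h => absurd hc h
    · filter_upwards [ae_tendsto_empFreq hν hP hq c hc] with z hz _ using hz
  -- Contexts of probability zero carry no frequency limit, but almost surely none occurs, at time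
  -- `0` or, by stationarity, at any later time.
  have hseen : ∀ᵐ z ∂ν, ν (context P k ⁻¹' {context P k z}) ≠ 0 := by
    have : ∀ᵐ z ∂ν, ∀ c, ν (context P k ⁻¹' {c}) = 0 → context P k z ≠ c := by
      refine ae_all_iff.mpr fun c => ?_
      by_cases hc : ν (context P k ⁻¹' {c}) = 0
      · filter_upwards [measure_eq_zero_iff_ae_notMem.mp hc] with z hz _ using hz
      · exact ae_of_all _ fun z h => absurd h hc
    filter_upwards [this] with z hz h using hz _ h rfl
  have hseen' : ∀ᵐ z ∂ν, ∀ n : ℕ, ν (context P k ⁻¹' {context P k (translate n z)}) ≠ 0 :=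
    ae_all_iff.mpr fun n =>
      (measurePreserving_translate hν n).quasiMeasurePreserving.tendsto_ae.eventually hseen
  filter_upwards [hfreq, hseen'] with z hz hs
  rw [Metric.tendsto_nhds]
  intro ε hε
  -- The context at time `n` varies with `n`, so convergence must be uniform in `c`; finiteness
  -- provides this.
  have hall : ∀ᶠ n : ℕ in atTop, ∀ c, ν (context P k ⁻¹' {c}) ≠ 0 →
      dist (1 - empFreq P k n 0 (outcomes z) (sideInfo z) c.1 c.2) (q c) < ε := by
    refine eventually_all.mpr fun c => ?_
    by_cases hc : ν (context P k ⁻¹' {c}) = 0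
    · exact Eventually.of_forall fun n h => absurd hc h
    · filter_upwards [Metric.tendsto_nhds.mp (hz c hc) ε hε] with n hn _ using hn
  filter_upwards [hall, eventually_ge_atTop k] with n hn hk
  have h := hn _ (hs n)
  rw [context_translate P hk] at h
  rw [dist_zero_right, hq, context_translate P hk, ← dist_eq_norm]
  exact h

/-- The asymptotic risk of an expert exceeds the Bayes risk by at most twice the `L¹` error of
its context posterior. -/
theorem ae_expert_risk (hν : Ergodic shift ν) (hP : ∀ j, MeasurableSet (P.cell j)) :
    ∀ᵐ z ∂ν, ∃ B : ℕ → ℝ,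
      Tendsto B atTop (𝓝 (∫ z, min (posterior ν z) (1 - posterior ν z) ∂ν +
        2 * ∫ z, |contextPosterior ν P k z - posterior ν z| ∂ν)) ∧
      ∀ n, timeAvg (fun i => bit (expert P k i (outcomes z) (sideInfo z)) +
        posterior ν (translate i z) - 2 * bit (expert P k i (outcomes z) (sideInfo z)) *
          posterior ν (translate i z)) n ≤ B n := by
  have hf := measurable_posterior (ν := ν)
  have hf01 := fun z => And.intro (posterior_nonneg (ν := ν) z) (posterior_le_one (ν := ν) z)
  obtain ⟨C, hC⟩ := exists_abs_contextPosterior_le ν P k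
  have hmin : ∀ z, |min (posterior ν z) (1 - posterior ν z)| ≤ 1 := fun z => by
    rw [abs_of_nonneg (le_min (hf01 z).1 (by linarith [(hf01 z).2]))]
    exact (min_le_left _ _).trans (hf01 z).2
  have hdiff : ∀ z, |(|contextPosterior ν P k z - posterior ν z|)| ≤ C + 1 := fun z => by
    rw [abs_abs]
    refine (abs_sub _ _).trans (add_le_add (hC z) ?_)
    rw [abs_of_nonneg (hf01 z).1]
    exact (hf01 z).2
  filter_upwards [ae_tendsto_estimate_sub (k := k) hν hP,
    ae_tendsto_timeAvg hν (g := fun z => min (posterior ν z) (1 - posterior ν z))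
      (hf.min (measurable_const.sub hf)) hmin,
    ae_tendsto_timeAvg hν (g := fun z => |contextPosterior ν P k z - posterior ν z|)
      ((measurable_contextPosterior hP).sub hf).abs hdiff] with z h1 h2 h3
  have h4 := tendsto_timeAvg h1.abs
  rw [abs_zero] at h4
  refine ⟨_, (h2.add (h3.const_mul 2)).add (h4.const_mul 2) |>.trans (by simp), fun n => ?_⟩
  rw [← timeAvg_const_mul, ← timeAvg_const_mul, ← timeAvg_add, ← timeAvg_add]
  refine timeAvg_mono (fun i _ => (expert_risk_le P k i z).trans ?_) n
  have := abs_sub_le (estimate P k i z) (contextPosterior ν P k (translate i z))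
    (posterior ν (translate i z))
  linarith

end Experts

/-! ### Refining contexts recover the whole past -/

section Levy

variable {E : Type*} [SeminormedAddCommGroup E] [MeasurableSpace E]
  {P : ℕ → FinitePartition E}

theorem FinitePartition.Refines.exists_quantizer_eq {E : Type*} {Q P : FinitePartition E}
    (h : Q.Refines P) : ∃ r : Fin Q.size → Fin P.size, ∀ x, P.quantizer x = r (Q.quantizer x) := by
  choose r hr using h
  exact ⟨r, fun x => (P.quantizer_eq_iff x _).mpr (hr _ ((Q.quantizer_eq_iff x _).mp rfl))⟩

/-- The increasing σ-algebras generated by the quantized contexts of orders `k = ℓ = 1, 2, …`. -/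
def contextFiltration (hP_meas : ∀ l, 1 ≤ l → ∀ j, MeasurableSet ((P l).cell j))
    (hP_nested : ∀ l, 1 ≤ l → (P (l + 1)).Refines (P l)) :
    Filtration ℕ (MeasurableSpace.pi : MeasurableSpace (ℤ → E × Fin 2)) where
  seq k := MeasurableSpace.comap (context (P (k + 1)) (k + 1)) inferInstance
  mono' := monotone_nat_of_le_succ fun k => by
    rw [← measurable_iff_comap_le]
    obtain ⟨r, hr⟩ := (hP_nested (k + 1) (by omega)).exists_quantizer_eq
    have h := measurable_context_iff.mp
      (comap_measurable (m := inferInstance) (context (E := E) (P (k + 1 + 1)) (k + 1 + 1)))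
    -- The shorter context is the longer one with its oldest entry dropped, so positions move by
    -- one, and its cells are coarsened by `r`.
    have e : ∀ j : ℕ, ((j + 1 : ℕ) : ℤ) - ((k + 1 + 1 : ℕ) : ℤ) = (j : ℤ) - ((k + 1 : ℕ) : ℤ) :=
      fun j => by push_cast; ring
    refine measurable_context_iff.mpr ⟨fun j => ?_, fun j => ?_⟩
    · have h1 := h.1 j.succ
      rwa [Fin.val_succ, e] at h1
    · have h1 := h.2 j.succ
      rw [Fin.val_succ, e] at h1
      simp only [hr]
      exact (measurable_of_finite r).comp h1
  le' k := (measurable_context (hP_meas (k + 1) (by omega))).comap_le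

theorem exists_cell_subset_of_isOpen {E : Type*} [SeminormedAddCommGroup E]
    {P : ℕ → FinitePartition E}
    (hP_diam : ∀ r : ℝ, 0 < r →
      Tendsto (fun l => (P l).maxDiamOn (Metric.closedBall 0 r)) atTop (𝓝 0))
    {U : Set E} (hU : IsOpen U) {x : E} (hx : x ∈ U) :
    ∀ᶠ l in atTop, (P l).cell ((P l).quantizer x) ⊆ U := by
  obtain ⟨ε, hε, hball⟩ := Metric.isOpen_iff.mp hU x hx
  have h := hP_diam (‖x‖ + 1) (by positivity)
  filter_upwards [h.eventually_lt_const (ENNReal.ofReal_pos.mpr hε)] with l hl y hy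
  have hxl : x ∈ (P l).cell ((P l).quantizer x) := ((P l).quantizer_eq_iff x _).mp rfl
  have hle : Metric.ediam ((P l).cell ((P l).quantizer x)) ≤
      (P l).maxDiamOn (Metric.closedBall 0 (‖x‖ + 1)) :=
    le_iSup₂_of_le (f := fun (j : Fin (P l).size)
      (_ : ((P l).cell j ∩ Metric.closedBall 0 (‖x‖ + 1)).Nonempty) => Metric.ediam ((P l).cell j))
      ((P l).quantizer x) ⟨x, hxl, by simp⟩ le_rfl
  refine hball ?_
  rw [Metric.mem_ball, ← ENNReal.ofReal_lt_ofReal_iff hε, ← edist_dist]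
  exact ((Metric.edist_le_ediam_of_mem hy hxl).trans hle).trans_lt hl

/-- Outcomes appear in the contexts unquantized. For side information, shrinking cells make every
open set a countable union of cells, so quantized values determine the Borel structure. -/
theorem iSup_contextFiltration [BorelSpace E]
    (hP_meas : ∀ l, 1 ≤ l → ∀ j, MeasurableSet ((P l).cell j))
    (hP_nested : ∀ l, 1 ≤ l → (P (l + 1)).Refines (P l))
    (hP_diam : ∀ r : ℝ, 0 < r →
      Tendsto (fun l => (P l).maxDiamOn (Metric.closedBall 0 r)) atTop (𝓝 0)) :
    ⨆ k, contextFiltration hP_meas hP_nested k = pastCoord E := by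
  refine le_antisymm (iSup_le fun k => ?_) ?_
  · exact (measurable_context_pastCoord (hP_meas (k + 1) (by omega))).comap_le
  · set m := ⨆ k, contextFiltration hP_meas hP_nested k with hm
    have h : ∀ k, Measurable[m] (context (P (k + 1)) (k + 1)) := fun k =>
      measurable_iff_comap_le.mpr (le_iSup (fun k => contextFiltration hP_meas hP_nested k) k)
    refine pastCoord_le_iff.mpr ⟨fun n hn => ?_, fun n hn => ?_⟩
    · have h1 := (measurable_context_iff.mp (h n.natAbs)).1 ⟨1, by omega⟩
      convert h1 using 4
      change n = ((1 : ℕ) : ℤ) - ((n.natAbs + 1 : ℕ) : ℤ)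
      omega
    · refine measurable_of_isOpen fun U hU => ?_
      have hq : ∀ k, n.natAbs ≤ k → Measurable[m] fun z : ℤ → E × Fin 2 =>
          (P (k + 1)).quantizer (z n).1 := fun k hk => by
        have h1 := (measurable_context_iff.mp (h k)).2 ⟨k + 1 - n.natAbs, by omega⟩
        convert h1 using 5
        change n = ((k + 1 - n.natAbs : ℕ) : ℤ) - ((k + 1 : ℕ) : ℤ)
        omega
      have hset : (fun z : ℤ → E × Fin 2 => (z n).1) ⁻¹' U = ⋃ k : ℕ,
          ⋃ _ : n.natAbs ≤ k, (fun z : ℤ → E × Fin 2 => (P (k + 1)).quantizer (z n).1) ⁻¹'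
            {j | (P (k + 1)).cell j ⊆ U} := by
        ext z
        simp only [Set.mem_preimage, Set.mem_iUnion]
        constructor
        · intro hz
          have h2 := (tendsto_add_atTop_nat 1).eventually
            (exists_cell_subset_of_isOpen hP_diam hU hz)
          obtain ⟨k, hk1, hk2⟩ := (h2.and (eventually_ge_atTop n.natAbs)).exists
          exact ⟨k, hk2, hk1⟩
        · rintro ⟨k, -, hk⟩
          exact hk (((P (k + 1)).quantizer_eq_iff _ _).mp rfl)
      rw [hset]
      exact MeasurableSet.iUnion fun k => MeasurableSet.iUnion fun hk =>
        hq k hk (Set.toFinite _).measurableSet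

/-- The context posteriors converge to the posterior in `L¹`. -/
theorem tendsto_integral_contextPosterior_sub [BorelSpace E]
    (hP_meas : ∀ l, 1 ≤ l → ∀ j, MeasurableSet ((P l).cell j))
    (hP_nested : ∀ l, 1 ≤ l → (P (l + 1)).Refines (P l))
    (hP_diam : ∀ r : ℝ, 0 < r →
      Tendsto (fun l => (P l).maxDiamOn (Metric.closedBall 0 r)) atTop (𝓝 0))
    (ν : Measure (ℤ → E × Fin 2)) [IsProbabilityMeasure ν] :
    Tendsto (fun k : ℕ => ∫ z, |contextPosterior ν (P (k + 1)) (k + 1) z - posterior ν z| ∂ν)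
      atTop (𝓝 0) := by
  have h := tendsto_eLpNorm_condExp (μ := ν) (ℱ := contextFiltration hP_meas hP_nested)
    fun z => bit (z 0).2
  rw [iSup_contextFiltration hP_meas hP_nested hP_diam] at h
  have h2 := (ENNReal.tendsto_toReal ENNReal.zero_ne_top).comp h
  refine h2.congr fun k => ?_
  have hint : Integrable (fun z => contextPosterior ν (P (k + 1)) (k + 1) z - posterior ν z) ν :=
    integrable_condExp.sub (integrable_condExp.congr posterior_ae_eq.symm)
  simp only [← Real.norm_eq_abs]
  rw [Function.comp, integral_norm_eq_lintegral_enorm hint.aestronglyMeasurable,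
    eLpNorm_one_eq_lintegral_enorm]
  congr 1
  refine lintegral_congr_ae ?_
  filter_upwards [posterior_ae_eq (ν := ν)] with z hz
  rw [hz]
  rfl

end Levy

/-! ### Predictions depend measurably on the observed past -/

section Measurability

variable {E : Type*} [MeasurableSpace E] {α : Type*} [MeasurableSpace α]
  {y : α → ℕ → Fin 2} {x : α → ℕ → E} {n : ℕ}

theorem measurable_block {β : Type*} [MeasurableSpace β] {a : α → ℕ → β} {s len : ℕ}
    (h : ∀ i < s + len, Measurable fun ω => a ω i) : Measurable fun ω => block (a ω) s len :=
  measurable_pi_lambda _ fun j => h _ (by omega)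

theorem measurable_expert {P : FinitePartition E} (hP : ∀ j, MeasurableSet (P.cell j)) (k : ℕ)
    (hy : ∀ i < n, Measurable fun ω => y ω i) (hx : ∀ i ≤ n, Measurable fun ω => x ω i) :
    Measurable fun ω => expert P k n (y ω) (x ω) := by
  -- For small `n` truncated subtraction could make the blocks reach past the observed times; there
  -- the default frequency makes the prediction constant.
  by_cases hn : n ≤ k + 1
  · simp [expert, empFreq, hn]
  have hbs : ∀ i, k < i → i ≤ n → Measurable fun ω => block (y ω) (i - k) k :=
    fun i hk hi => measurable_block fun j hj => hy j (by omega)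
  have hbz : ∀ i, k < i → i ≤ n →
      Measurable fun ω => block (fun t => P.quantizer (x ω t)) (i - k) (k + 1) :=
    fun i hk hi => measurable_block (a := fun ω t => P.quantizer (x ω t)) fun j hj =>
      (measurable_quantizer hP).comp (hx j (by omega))
  have hmatch : ∀ i ∈ Finset.Ioo k n, MeasurableSet {ω | block (y ω) (i - k) k =
      block (y ω) (n - k) k ∧ block (fun t => P.quantizer (x ω t)) (i - k) (k + 1) =
      block (fun t => P.quantizer (x ω t)) (n - k) (k + 1)} := fun i hi => by
    have hi' := Finset.mem_Ioo.mp hi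
    exact (measurableSet_eq_fun (hbs i hi'.1 hi'.2.le) (hbs n (by omega) le_rfl)).inter
      (measurableSet_eq_fun (hbz i hi'.1 hi'.2.le) (hbz n (by omega) le_rfl))
  have h1 : Measurable fun ω => (matchTimes P k n (y ω) (x ω) (block (y ω) (n - k) k)
      (block (fun t => P.quantizer (x ω t)) (n - k) (k + 1))).card := by
    simp only [matchTimes, Finset.card_filter]
    exact Finset.measurable_fun_sum _ fun i hi =>
      Measurable.ite (hmatch i hi) measurable_const measurable_const
  have h2 : Measurable fun ω => ((matchTimes P k n (y ω) (x ω) (block (y ω) (n - k) k)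
      (block (fun t => P.quantizer (x ω t)) (n - k) (k + 1))).filter
        fun i => y ω i = 0).card := by
    simp only [matchTimes, Finset.filter_filter, Finset.card_filter]
    exact Finset.measurable_fun_sum _ fun i hi =>
      Measurable.ite ((hmatch i hi).inter
        (hy i (Finset.mem_Ioo.mp hi).2 (measurableSet_singleton 0)))
        measurable_const measurable_const
  have h3 : Measurable fun ω => empFreq P k n 0 (y ω) (x ω) (block (y ω) (n - k) k)
      (block (fun t => P.quantizer (x ω t)) (n - k) (k + 1)) :=
    (measurable_of_countable fun c : ℕ × ℕ =>
      if n ≤ k + 1 ∨ c.2 = 0 then (1 / 2 : ℝ) else (c.1 : ℝ) / (c.2 : ℝ)).comp (h2.prodMk h1)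
  exact Measurable.ite (measurableSet_lt measurable_const h3) measurable_const measurable_const

theorem measurable_weight {P : FinitePartition E} (hP : ∀ j, MeasurableSet (P.cell j)) (k : ℕ)
    (hy : ∀ i < n, Measurable fun ω => y ω i) (hx : ∀ i ≤ n, Measurable fun ω => x ω i) :
    Measurable fun ω => weight P k n (y ω) (x ω) := by
  simp only [weight, avgLoss]
  split_ifs
  · exact measurable_const
  · refine Real.measurable_exp.comp (measurable_const.mul (Measurable.div_const ?_ _))
    refine Finset.measurable_fun_sum _ fun i hi => ?_
    have hi' := Finset.mem_Icc.mp hi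
    have hpos : 0 < 2 ^ Nat.log 2 n := by positivity
    refine Measurable.ite (measurableSet_eq_fun (measurable_expert hP k
      (fun j hj => hy j (by omega)) fun j hj => hx j (by omega)) (hy i (by omega))).compl
      measurable_const measurable_const

end Measurability

/-! ### Regret of the weighted vote on individual sequences -/

section Vote

variable {E : Type*}

/-- The weighted fraction of the experts that predict `1` at time `n`. -/
def voteShare (P : ℕ → FinitePartition E) (n : ℕ) (y : ℕ → Fin 2) (x : ℕ → E) : ℝ :=
  let N := 2 ^ (Nat.log 2 n + 1)
  (∑ k ∈ Finset.Icc 1 N, ∑ l ∈ Finset.Icc 1 N,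
    ((expert (P l) k n y x : ℕ) : ℝ) * weight (P l) k n y x) /
      (∑ k ∈ Finset.Icc 1 N, ∑ l ∈ Finset.Icc 1 N, weight (P l) k n y x)

theorem bit_scheme (P : ℕ → FinitePartition E) (n : ℕ) (y : ℕ → Fin 2) (x : ℕ → E) (u : ℝ) :
    bit (scheme P n y x u) = if voteShare P n y x < u then 0 else 1 := by
  have : scheme P n y x u = if voteShare P n y x < u then 0 else 1 := rfl
  rw [this]
  split_ifs <;> simp

theorem measurable_voteShare [MeasurableSpace E] {P : ℕ → FinitePartition E}
    (hP : ∀ l, 1 ≤ l → ∀ j, MeasurableSet ((P l).cell j)) {α : Type*} [MeasurableSpace α]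
    {y : α → ℕ → Fin 2} {x : α → ℕ → E} {n : ℕ}
    (hy : ∀ i < n, Measurable fun ω => y ω i) (hx : ∀ i ≤ n, Measurable fun ω => x ω i) :
    Measurable fun ω => voteShare P n (y ω) (x ω) := by
  have hw : ∀ k, ∀ l ∈ Finset.Icc 1 (2 ^ (Nat.log 2 n + 1)),
      Measurable fun ω => weight (P l) k n (y ω) (x ω) := fun k l hl =>
    measurable_weight (hP l (Finset.mem_Icc.mp hl).1) k hy hx
  have hh : ∀ k, ∀ l ∈ Finset.Icc 1 (2 ^ (Nat.log 2 n + 1)),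
      Measurable fun ω => bit (expert (P l) k n (y ω) (x ω)) := fun k l hl =>
    measurable_bit.comp (measurable_expert (hP l (Finset.mem_Icc.mp hl).1) k hy hx)
  exact (Finset.measurable_fun_sum _ fun k _ => Finset.measurable_fun_sum _ fun l hl =>
    (hh k l hl).mul (hw k l hl)).div
    (Finset.measurable_fun_sum _ fun k _ => Finset.measurable_fun_sum _ fun l hl => hw k l hl)

theorem weight_pos (P : FinitePartition E) (k n : ℕ) (y : ℕ → Fin 2) (x : ℕ → E) :
    0 < weight P k n y x := by
  unfold weight
  dsimp only
  split_ifs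
  · exact one_pos
  · exact Real.exp_pos _

theorem voteShare_nonneg (P : ℕ → FinitePartition E) (n : ℕ) (y : ℕ → Fin 2) (x : ℕ → E) :
    0 ≤ voteShare P n y x :=
  div_nonneg (Finset.sum_nonneg fun _ _ => Finset.sum_nonneg fun _ _ =>
    mul_nonneg (Nat.cast_nonneg _) (weight_pos _ _ _ _ _).le)
    (Finset.sum_nonneg fun _ _ => Finset.sum_nonneg fun _ _ => (weight_pos _ _ _ _ _).le)

theorem voteShare_le_one (P : ℕ → FinitePartition E) (n : ℕ) (y : ℕ → Fin 2) (x : ℕ → E) :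
    voteShare P n y x ≤ 1 :=
  div_le_one_of_le₀ (Finset.sum_le_sum fun _ _ => Finset.sum_le_sum fun _ _ =>
    mul_le_of_le_one_left (weight_pos _ _ _ _ _).le (bit_le_one _))
    (Finset.sum_nonneg fun _ _ => Finset.sum_nonneg fun _ _ => (weight_pos _ _ _ _ _).le)

/-- The expected loss of predicting `1` with probability `p`, when the outcome is `b`. -/
def linLoss (p : ℝ) (b : Fin 2) : ℝ := p + bit b - 2 * p * bit b

theorem linLoss_nonneg {p : ℝ} (h0 : 0 ≤ p) (h1 : p ≤ 1) (b : Fin 2) : 0 ≤ linLoss p b := by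
  rcases bit_eq_zero_or_one b with h | h <;> rw [linLoss, h] <;> linarith

theorem linLoss_le_one {p : ℝ} (h0 : 0 ≤ p) (h1 : p ≤ 1) (b : Fin 2) : linLoss p b ≤ 1 := by
  rcases bit_eq_zero_or_one b with h | h <;> rw [linLoss, h] <;> linarith

theorem weight_eq_exp (P : FinitePartition E) (k : ℕ) {m n : ℕ} (h1 : 2 ^ m ≤ n)
    (h2 : n < 2 ^ (m + 1)) (y : ℕ → Fin 2) (x : ℕ → E) :
    weight P k n y x = Real.exp (-learningRate m *
      ∑ r ∈ Finset.Ico (2 ^ m) n, linLoss (bit (expert P k r y x)) (y r)) := by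
  have hlog : Nat.log 2 n = m := Nat.log_eq_of_pow_le_of_lt_pow h1 h2
  simp only [weight, hlog]
  split_ifs with h
  · simp [h]
  · have hlt : 2 ^ m < n := lt_of_le_of_ne h1 (Ne.symm h)
    have hpos : (0 : ℝ) < n - 2 ^ m := sub_pos.mpr (by exact_mod_cast hlt)
    have hset : Finset.Icc (2 ^ m) (n - 1) = Finset.Ico (2 ^ m) n := by
      ext i; simp only [Finset.mem_Icc, Finset.mem_Ico]; omega
    have hden : ((n - 1 : ℕ) : ℝ) - ((2 ^ m : ℕ) : ℝ) + 1 = n - 2 ^ m := by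
      rw [Nat.cast_sub (by omega)]
      push_cast
      ring
    rw [avgLoss, hset, hden, mul_assoc, mul_div_cancel₀ _ hpos.ne']
    simp only [ite_ne_eq_bit, linLoss]

/-- The regret against a fixed expert on one block of the doubling scheme. -/
theorem sum_Ico_linLoss_sub_le (P : ℕ → FinitePartition E) {k l : ℕ} (hk : 1 ≤ k) (hl : 1 ≤ l)
    (y : ℕ → Fin 2) (x : ℕ → E) (m n : ℕ) (h1 : 2 ^ m ≤ n) (h2 : n ≤ 2 ^ (m + 1)) :
    ∑ i ∈ Finset.Ico (2 ^ m) n, (linLoss (voteShare P i y x) (y i) -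
        linLoss (bit (expert (P l) k i y x)) (y i)) ≤
      if k ≤ 2 ^ (m + 1) ∧ l ≤ 2 ^ (m + 1) then 2 * learningRate m * 2 ^ m else 2 ^ m := by
  have hlen : (n : ℝ) - 2 ^ m ≤ 2 ^ m := by
    have : (n : ℝ) ≤ 2 ^ (m + 1) := by exact_mod_cast h2
    rw [pow_succ] at this
    linarith
  have hbit := fun (l k i : ℕ) =>
    And.intro (bit_nonneg (expert (P l) k i y x)) (bit_le_one (expert (P l) k i y x))
  split_ifs with hkl
  · set N := 2 ^ (m + 1) with hN
    set s : Finset (ℕ × ℕ) := Finset.Icc 1 N ×ˢ Finset.Icc 1 N with hs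
    have hmem : (k, l) ∈ s := by simp [hs, hk, hl, hkl]
    have hη := learningRate_pos m
    have key := sum_weightedAverage_le s hη
      (fun t i => linLoss (bit (expert (P i.2) i.1 t y x)) (y t))
      (fun t i => linLoss_nonneg (hbit _ _ _).1 (hbit _ _ _).2 _)
      (fun t i => linLoss_le_one (hbit _ _ _).1 (hbit _ _ _).2 _) (2 ^ m) n h1 hmem
    have hcard : (s.card : ℝ) = ((2 : ℝ) ^ (m + 1)) ^ 2 := by
      rw [hs, Finset.card_product, Nat.card_Icc, hN]
      push_cast [Nat.add_sub_cancel]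
      ring
    -- Since `linLoss` is affine in the prediction, the loss of the average vote is the weighted
    -- average of the experts' losses.
    have hshare : ∀ t ∈ Finset.Ico (2 ^ m) n, linLoss (voteShare P t y x) (y t) =
        (∑ i ∈ s, Real.exp (-learningRate m * ∑ r ∈ Finset.Ico (2 ^ m) t,
          linLoss (bit (expert (P i.2) i.1 r y x)) (y r)) *
            linLoss (bit (expert (P i.2) i.1 t y x)) (y t)) /
        ∑ i ∈ s, Real.exp (-learningRate m * ∑ r ∈ Finset.Ico (2 ^ m) t,
          linLoss (bit (expert (P i.2) i.1 r y x)) (y r)) := by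
      intro t ht
      have ht' := Finset.mem_Ico.mp ht
      have hlt : t < 2 ^ (m + 1) := ht'.2.trans_le h2
      have hlog : Nat.log 2 t = m := Nat.log_eq_of_pow_le_of_lt_pow ht'.1 hlt
      simp only [← weight_eq_exp _ _ ht'.1 hlt]
      have hW : 0 < ∑ i ∈ s, weight (P i.2) i.1 t y x :=
        Finset.sum_pos (fun i _ => weight_pos _ _ _ _ _) ⟨_, hmem⟩
      have hv : voteShare P t y x = (∑ i ∈ s, bit (expert (P i.2) i.1 t y x) *
          weight (P i.2) i.1 t y x) / ∑ i ∈ s, weight (P i.2) i.1 t y x := by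
        rw [hs, Finset.sum_product, Finset.sum_product, hN, ← hlog]
        rfl
      rw [eq_div_iff hW.ne', linLoss]
      have hv' : voteShare P t y x * ∑ i ∈ s, weight (P i.2) i.1 t y x =
          ∑ i ∈ s, bit (expert (P i.2) i.1 t y x) * weight (P i.2) i.1 t y x := by
        rw [hv, div_mul_cancel₀ _ hW.ne']
      calc _ = (voteShare P t y x * ∑ i ∈ s, weight (P i.2) i.1 t y x) * (1 - 2 * bit (y t)) +
            bit (y t) * ∑ i ∈ s, weight (P i.2) i.1 t y x := by ring
        _ = _ := by
          rw [hv', Finset.sum_mul, Finset.mul_sum, ← Finset.sum_add_distrib]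
          refine Finset.sum_congr rfl fun i _ => ?_
          rw [linLoss]
          ring
    rw [← Finset.sum_congr rfl hshare, hcard, log_div_learningRate] at key
    rw [Finset.sum_sub_distrib]
    push_cast at key
    have h3 := mul_le_mul_of_nonneg_left hlen hη.le
    have h4 : 0 ≤ learningRate m * 2 ^ m := by positivity
    linarith
  -- The expert is not yet in the pool, so only the block length bounds the regret. This happens for
  -- finitely many `m` and does not affect the limit.
  · calc ∑ i ∈ Finset.Ico (2 ^ m) n, (linLoss (voteShare P i y x) (y i) -
          linLoss (bit (expert (P l) k i y x)) (y i)) ≤ ∑ _i ∈ Finset.Ico (2 ^ m) n, (1 : ℝ) := by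
          refine Finset.sum_le_sum fun i _ => ?_
          have h3 := linLoss_le_one (voteShare_nonneg P i y x) (voteShare_le_one P i y x) (y i)
          have h4 := linLoss_nonneg (hbit l k i).1 (hbit l k i).2 (y i)
          linarith
      _ = (n : ℝ) - 2 ^ m := by
          rw [Finset.sum_const, Nat.card_Ico, nsmul_eq_mul, mul_one, Nat.cast_sub h1]
          push_cast
          rfl
      _ ≤ 2 ^ m := hlen

/-- The average expected loss of the vote is asymptotically at most that of any expert. -/
theorem exists_regret (P : ℕ → FinitePartition E) {k l : ℕ} (hk : 1 ≤ k) (hl : 1 ≤ l)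
    (y : ℕ → Fin 2) (x : ℕ → E) :
    ∃ R : ℕ → ℝ, Tendsto R atTop (𝓝 0) ∧ ∀ n,
      timeAvg (fun i => linLoss (voteShare P i y x) (y i)) n ≤
      timeAvg (fun i => linLoss (bit (expert (P l) k i y x)) (y i)) n + R n := by
  set e : ℕ → ℝ := fun m =>
    if k ≤ 2 ^ (m + 1) ∧ l ≤ 2 ^ (m + 1) then 2 * learningRate m * 2 ^ m else 2 ^ m with he
  refine ⟨fun n => (∑ j ∈ Finset.range (Nat.log 2 n + 1), e j) / n,
    tendsto_sum_dyadic_div ?_, fun n => ?_⟩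
  · have h := tendsto_learningRate.const_mul 2
    rw [mul_zero] at h
    refine h.congr' ?_
    filter_upwards [eventually_ge_atTop k, eventually_ge_atTop l] with m hm1 hm2
    have h3 : m < 2 ^ (m + 1) := (Nat.lt_two_pow_self).trans
      (Nat.pow_lt_pow_right one_lt_two m.lt_succ_self)
    have hpos : (0 : ℝ) < 2 ^ m := by positivity
    simp only [he]
    rw [if_pos ⟨by omega, by omega⟩, mul_div_cancel_right₀ _ hpos.ne']
  · rcases Nat.eq_zero_or_pos n with rfl | hn
    · simp [timeAvg]
    · have h := sum_Ico_one_le_sum_dyadic (sum_Ico_linLoss_sub_le P hk hl y x) hn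
      rw [Finset.sum_sub_distrib] at h
      have hset : Finset.Icc 1 n = Finset.Ico 1 (n + 1) := rfl
      rw [timeAvg, timeAvg, ← add_div, hset]
      gcongr
      linarith

end Vote

/-! ### Removing the randomization -/

section Randomization

variable {Ω ζ : Type*} [MeasurableSpace Ω] [MeasurableSpace ζ] {μ : Measure Ω}
  [IsProbabilityMeasure μ]

theorem measurable_threshold {β : Type*} [MeasurableSpace β] {a v : β → ℝ} (ha : Measurable a)
    (hv : Measurable v) : Measurable fun b => (if a b < v b then (0 : ℝ) else 1) - a b :=
  (Measurable.ite (measurableSet_lt ha hv) measurable_const measurable_const).sub ha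

theorem abs_threshold_le {a : ℝ} (h0 : 0 ≤ a) (h1 : a ≤ 1) (v : ℝ) :
    |(if a < v then (0 : ℝ) else 1) - a| ≤ 1 := by
  rw [abs_le]
  split_ifs <;> constructor <;> linarith

theorem integral_threshold_eq_zero {V : Ω → ℝ} (hV : Measurable V)
    (hunif : μ.map V = volume.restrict (Set.Icc (0 : ℝ) 1)) {a : ℝ} (h0 : 0 ≤ a) (h1 : a ≤ 1) :
    ∫ ω, ((if a < V ω then (0 : ℝ) else 1) - a) ∂μ = 0 := by
  have hm : Measurable fun v : ℝ => if a < v then (0 : ℝ) else 1 :=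
    Measurable.ite measurableSet_Ioi measurable_const measurable_const
  have h2 : ∫ ω, (if a < V ω then (0 : ℝ) else 1) ∂μ = a := by
    rw [← integral_map (f := fun v : ℝ => if a < v then (0 : ℝ) else 1) hV.aemeasurable
      hm.aestronglyMeasurable, hunif]
    have h3 : (fun v : ℝ => if a < v then (0 : ℝ) else 1) = (Set.Iic a).indicator 1 := by
      funext v
      by_cases hv : a < v
      · rw [if_pos hv, Set.indicator_of_notMem (by simpa using hv)]
      · rw [if_neg hv, Set.indicator_of_mem (by simpa using hv), Pi.one_apply]
    rw [h3, integral_indicator_one measurableSet_Iic, Measure.real,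
      Measure.restrict_apply measurableSet_Iic]
    have h4 : Set.Iic a ∩ Set.Icc 0 1 = Set.Icc 0 a := by
      ext v
      simp only [Set.mem_inter_iff, Set.mem_Iic, Set.mem_Icc]
      constructor
      · rintro ⟨h, h', -⟩; exact ⟨h', h⟩
      · rintro ⟨h, h'⟩; exact ⟨h', h, h'.trans h1⟩
    rw [h4, Real.volume_Icc, sub_zero, ENNReal.toReal_ofReal h0]
  have hi : Integrable (fun ω => if a < V ω then (0 : ℝ) else 1) μ :=
    integrable_of_measurable_of_abs_le (hm.comp hV) (C := 1) fun ω => by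
      split_ifs <;> simp
  rw [integral_sub hi (integrable_const _), h2]
  simp

/-- Averaged over time, decisions taken by independent uniform thresholds agree with their
conditional probabilities. -/
theorem ae_tendsto_timeAvg_threshold {U : ℕ → Ω → ℝ} {Z : Ω → ζ} (hZ : Measurable Z)
    (hU : ∀ i, 1 ≤ i → Measurable (U i))
    (hU_unif : ∀ i, 1 ≤ i → μ.map (U i) = volume.restrict (Set.Icc (0 : ℝ) 1))
    (hU_indep : iIndepFun (fun i : ℕ => U (i + 1)) μ)
    (hUZ : IndepFun (fun ω (i : ℕ) => U (i + 1) ω) Z μ)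
    {a c : ℕ → ζ → ℝ} (ha : ∀ i, Measurable (a i)) (ha0 : ∀ i z, 0 ≤ a i z)
    (ha1 : ∀ i z, a i z ≤ 1) (hc : ∀ i, Measurable (c i)) (hc1 : ∀ i z, |c i z| ≤ 1) :
    ∀ᵐ ω ∂μ, Tendsto (timeAvg fun i =>
      ((if a i (Z ω) < U i ω then (0 : ℝ) else 1) - a i (Z ω)) * c i (Z ω)) atTop (𝓝 0) := by
  have hV : Measurable fun ω (i : ℕ) => U (i + 1) ω :=
    measurable_pi_lambda _ fun i => hU (i + 1) (by omega)
  set G : ℕ → (ℕ → ℝ) × ζ → ℝ := fun i w =>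
    ((if a (i + 1) w.2 < w.1 i then (0 : ℝ) else 1) - a (i + 1) w.2) * c (i + 1) w.2 with hG
  have hGm : ∀ i, Measurable (G i) := fun i =>
    (measurable_threshold ((ha _).comp measurable_snd)
      ((measurable_pi_apply i).comp measurable_fst)).mul ((hc _).comp measurable_snd)
  have hG1 : ∀ i w, |G i w| ≤ 1 := fun i w => by
    simp only [hG, abs_mul]
    exact mul_le_one₀ (abs_threshold_le (ha0 _ _) (ha1 _ _) _) (abs_nonneg _) (hc1 _ _)
  have hVZ : Measurable fun ω => ((fun i : ℕ => U (i + 1) ω), Z ω) := hV.prodMk hZ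
  have key := ae_tendsto_sum_div_of_orthogonal (μ := μ) (C := 1)
    (D := fun i ω => G i ((fun i : ℕ => U (i + 1) ω), Z ω))
    (fun i => (hGm i).comp hVZ) (fun i ω => hG1 i _) ?_
  · filter_upwards [key] with ω hω
    refine hω.congr fun n => ?_
    rw [timeAvg_eq_range]
  · intro i j hij
    have hGG : Measurable fun w => G i w * G j w := (hGm i).mul (hGm j)
    -- The joint law is a product, so Fubini allows the trajectory to be frozen; the vote shares
    -- become constants and the two threshold errors are independent and centered.
    have hprod := (indepFun_iff_map_prod_eq_prod_map_map hV.aemeasurable hZ.aemeasurable).mp hUZ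
    have : IsProbabilityMeasure (μ.map fun ω (i : ℕ) => U (i + 1) ω) :=
      Measure.isProbabilityMeasure_map hV.aemeasurable
    have : IsProbabilityMeasure (μ.map Z) := Measure.isProbabilityMeasure_map hZ.aemeasurable
    rw [← integral_map (f := fun w => G i w * G j w) hVZ.aemeasurable hGG.aestronglyMeasurable,
      hprod, integral_prod_symm _ (integrable_of_measurable_of_abs_le hGG (C := 1) fun w => by
        rw [abs_mul]; exact mul_le_one₀ (hG1 i w) (abs_nonneg _) (hG1 j w))]
    refine integral_eq_zero_of_ae (ae_of_all _ fun z => ?_)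
    have hGz : Measurable fun v : ℕ → ℝ => G i (v, z) * G j (v, z) :=
      hGG.comp measurable_prodMk_right
    simp only [Pi.zero_apply]
    rw [integral_map (f := fun v : ℕ → ℝ => G i (v, z) * G j (v, z)) hV.aemeasurable
      hGz.aestronglyMeasurable]
    have hφ : ∀ i, Measurable fun v : ℝ =>
        (if a (i + 1) z < v then (0 : ℝ) else 1) - a (i + 1) z :=
      fun i => measurable_threshold measurable_const measurable_id
    have hind := ((hU_indep.indepFun hij.ne).comp (hφ i) (hφ j)).integral_mul_eq_mul_integral
      ((hφ i).comp (hU (i + 1) (by omega))).aestronglyMeasurable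
      ((hφ j).comp (hU (j + 1) (by omega))).aestronglyMeasurable
    have hzero := integral_threshold_eq_zero (hU (i + 1) (by omega)) (hU_unif (i + 1) (by omega))
      (ha0 (i + 1) z) (ha1 (i + 1) z)
    simp only [Function.comp_def, hzero, zero_mul] at hind
    calc ∫ ω, G i ((fun i : ℕ => U (i + 1) ω), z) * G j ((fun i : ℕ => U (i + 1) ω), z) ∂μ
        = ∫ ω, (c (i + 1) z * c (j + 1) z) *
          (((if a (i + 1) z < U (i + 1) ω then (0 : ℝ) else 1) - a (i + 1) z) *
          ((if a (j + 1) z < U (j + 1) ω then (0 : ℝ) else 1) - a (j + 1) z)) ∂μ :=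
          integral_congr_ae (ae_of_all _ fun ω => by simp only [hG]; ring)
      _ = 0 := by
          rw [integral_const_mul]
          exact mul_eq_zero_of_right _ hind

end Randomization

/-! ### The Bayes error on the trajectory space -/

section BayesError

variable {Ω E : Type*} [MeasurableSpace Ω] [MeasurableSpace E] {μ : Measure Ω}
  [IsProbabilityMeasure μ] {X : ℤ → Ω → E} {Y : ℤ → Ω → Fin 2}

theorem pastSigma_eq_comap {Ω E : Type*} [MeasurableSpace E] (X : ℤ → Ω → E) (Y : ℤ → Ω → Fin 2) :
    pastSigma X Y = (pastCoord E).comap fun ω n => (X n ω, Y n ω) := by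
  simp only [pastSigma, MeasurableSpace.comap_sup, MeasurableSpace.comap_iSup,
    MeasurableSpace.comap_comp]
  rfl

/-- The Bayes error as an integral over the space of trajectories. -/
theorem bayesError_eq (hX : ∀ n, Measurable (X n)) (hY : ∀ n, Measurable (Y n)) :
    bayesError μ X Y = ∫ z, min (posterior (μ.map fun ω n => (X n ω, Y n ω)) z)
      (1 - posterior (μ.map fun ω n => (X n ω, Y n ω)) z)
        ∂(μ.map fun ω n => (X n ω, Y n ω)) := by
  have hZ : Measurable fun ω (n : ℤ) => (X n ω, Y n ω) :=
    measurable_pi_lambda _ fun n => (hX n).prodMk (hY n)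
  set ν := μ.map fun ω (n : ℤ) => (X n ω, Y n ω) with hν
  have : IsProbabilityMeasure ν := Measure.isProbabilityMeasure_map hZ.aemeasurable
  have hφ : MeasurePreserving (fun ω (n : ℤ) => (X n ω, Y n ω)) μ ν := ⟨hZ, rfl⟩
  have hle : pastSigma X Y ≤ (inferInstance : MeasurableSpace Ω) := by
    rw [pastSigma_eq_comap]
    exact (MeasurableSpace.comap_mono pastCoord_le).trans hZ.comap_le
  have h1 : μ[fun ω => bit (Y 0 ω)|pastSigma X Y] =ᵐ[μ]
      fun ω => posterior ν fun n => (X n ω, Y n ω) := by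
    rw [pastSigma_eq_comap]
    exact (condExp_comp_ae_eq hφ pastCoord_le (integrable_bit_snd 0)).trans
      (hφ.quasiMeasurePreserving.ae_eq_comp posterior_ae_eq.symm)
  have e1 : ({ω | Y 0 ω = 1}.indicator fun _ => (1 : ℝ)) = fun ω => bit (Y 0 ω) := by
    funext ω
    simp only [Set.indicator, Set.mem_ofPred_eq]
    generalize Y 0 ω = b
    fin_cases b <;> simp
  have e0 : ({ω | Y 0 ω = 0}.indicator fun _ => (1 : ℝ)) =
      (fun _ => (1 : ℝ)) - fun ω => bit (Y 0 ω) := by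
    funext ω
    simp only [Set.indicator, Set.mem_ofPred_eq, Pi.sub_apply]
    generalize Y 0 ω = b
    fin_cases b <;> simp
  have hi : Integrable (fun ω => bit (Y 0 ω)) μ :=
    hφ.integrable_comp_of_integrable (integrable_bit_snd (ν := ν) 0)
  have h0 : μ[(fun _ => (1 : ℝ)) - fun ω => bit (Y 0 ω)|pastSigma X Y] =ᵐ[μ]
      (fun _ => (1 : ℝ)) - μ[fun ω => bit (Y 0 ω)|pastSigma X Y] := by
    have := condExp_sub (integrable_const (1 : ℝ)) hi (pastSigma X Y)
    rwa [condExp_const hle] at this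
  have hfm : Measurable fun z => min (posterior ν z) (1 - posterior ν z) :=
    measurable_posterior.min (measurable_const.sub measurable_posterior)
  rw [bayesError, e1, e0, hν, integral_map hZ.aemeasurable hfm.aestronglyMeasurable]
  refine integral_congr_ae ?_
  filter_upwards [h0, h1] with ω h0 h1
  rw [h0, Pi.sub_apply, h1]

end BayesError

/-! ### Convergence of the expected loss -/

section Vote

variable {E : Type*} [SeminormedAddCommGroup E] [MeasurableSpace E] [BorelSpace E]
  {P : ℕ → FinitePartition E} {ν : Measure (ℤ → E × Fin 2)} [IsProbabilityMeasure ν]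

/-- Conditional risk plus noise: with `f` the posterior and `p` known from the past, the second term
is a martingale difference. -/
theorem linLoss_eq (p f : ℝ) (b : Fin 2) :
    linLoss p b = (p + f - 2 * p * f) + (1 - 2 * p) * (bit b - f) := by
  rw [linLoss]; ring

theorem min_le_risk {p f : ℝ} (h0 : 0 ≤ p) (h1 : p ≤ 1) :
    min f (1 - f) ≤ p + f - 2 * p * f := by
  rcases min_cases f (1 - f) with ⟨h, h'⟩ | ⟨h, h'⟩ <;> rw [h] <;> nlinarith

theorem abs_one_sub_two_mul_le {p : ℝ} (h0 : 0 ≤ p) (h1 : p ≤ 1) : |1 - 2 * p| ≤ 1 := by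
  rw [abs_le]; constructor <;> linarith

/-- The average expected loss of the vote converges to the Bayes error. -/
theorem ae_tendsto_timeAvg_linLoss_voteShare (hν : Ergodic shift ν)
    (hP_meas : ∀ l, 1 ≤ l → ∀ j, MeasurableSet ((P l).cell j))
    (hP_nested : ∀ l, 1 ≤ l → (P (l + 1)).Refines (P l))
    (hP_diam : ∀ r : ℝ, 0 < r →
      Tendsto (fun l => (P l).maxDiamOn (Metric.closedBall 0 r)) atTop (𝓝 0)) :
    ∀ᵐ z ∂ν, Tendsto
      (timeAvg fun i => linLoss (voteShare P i (outcomes z) (sideInfo z)) (outcomes z i)) atTop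
      (𝓝 (∫ z, min (posterior ν z) (1 - posterior ν z) ∂ν)) := by
  have hf01 := fun z => And.intro (posterior_nonneg (ν := ν) z) (posterior_le_one (ν := ν) z)
  have hmin : ∀ z, |min (posterior ν z) (1 - posterior ν z)| ≤ 1 := fun z => by
    rw [abs_of_nonneg (le_min (hf01 z).1 (by linarith [(hf01 z).2]))]
    exact (min_le_left _ _).trans (hf01 z).2
  have hvote : ∀ i : ℕ, Measurable[pastAt E i] fun z : ℤ → E × Fin 2 =>
      1 - 2 * voteShare P i (outcomes z) (sideInfo z) := fun i => by
    -- Replacing the ambient instance makes the general measurability lemma yield measurability with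
    -- respect to the past.
    let _ : MeasurableSpace (ℤ → E × Fin 2) := pastAt E i
    exact measurable_const.sub (measurable_const.mul (measurable_voteShare hP_meas
      (fun j hj => measurable_snd_pastAt (by exact_mod_cast hj))
      fun j hj => measurable_fst_pastAt (by exact_mod_cast hj)))
  have hexp : ∀ k i : ℕ, Measurable[pastAt E i] fun z : ℤ → E × Fin 2 =>
      1 - 2 * bit (expert (P (k + 1)) (k + 1) i (outcomes z) (sideInfo z)) := fun k i => by
    let _ : MeasurableSpace (ℤ → E × Fin 2) := pastAt E i
    exact measurable_const.sub (measurable_const.mul (measurable_bit.comp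
      (measurable_expert (hP_meas (k + 1) (by omega)) (k + 1)
        (fun j hj => measurable_snd_pastAt (by exact_mod_cast hj))
        fun j hj => measurable_fst_pastAt (by exact_mod_cast hj))))
  filter_upwards [ae_tendsto_timeAvg_mul_sub_posterior hν hvote
      (fun i z => abs_one_sub_two_mul_le (voteShare_nonneg _ _ _ _) (voteShare_le_one _ _ _ _)),
    ae_all_iff.mpr fun k => ae_tendsto_timeAvg_mul_sub_posterior hν (hexp k)
      (fun i z => abs_one_sub_two_mul_le (bit_nonneg _) (bit_le_one _)),
    ae_all_iff.mpr fun k : ℕ => ae_expert_risk (k := k + 1) hν (hP_meas (k + 1) (by omega)),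
    ae_tendsto_timeAvg hν (g := fun z => min (posterior ν z) (1 - posterior ν z))
      (measurable_posterior.min (measurable_const.sub measurable_posterior)) hmin]
    with z hz1 hz2 hz3 hz4
  refine tendsto_order.mpr ⟨fun b hb => ?_, fun b hb => ?_⟩
  · have h := hz4.add hz1
    rw [add_zero] at h
    filter_upwards [h.eventually_const_lt hb] with n hn
    refine hn.trans_le ?_
    rw [← timeAvg_add]
    refine timeAvg_mono (fun i _ => ?_) n
    rw [linLoss_eq _ (posterior ν (translate i z))]
    gcongr
    exact min_le_risk (voteShare_nonneg _ _ _ _) (voteShare_le_one _ _ _ _)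
  -- Upper bound: one expert with limiting risk below `b` suffices, since the vote's regret against
  -- it vanishes.
  · have hlim := (tendsto_integral_contextPosterior_sub hP_meas hP_nested hP_diam ν).const_mul 2
      |>.const_add (∫ z, min (posterior ν z) (1 - posterior ν z) ∂ν)
    rw [mul_zero, add_zero] at hlim
    obtain ⟨k, hk⟩ := (hlim.eventually_lt_const hb).exists
    obtain ⟨B, hB, hle⟩ := hz3 k
    obtain ⟨R, hR, hreg⟩ := exists_regret P (k := k + 1) (l := k + 1) (by omega) (by omega)
      (outcomes z) (sideInfo z)
    have h := (hB.add (hz2 k)).add hR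
    rw [add_zero, add_zero] at h
    filter_upwards [h.eventually_lt_const hk] with n hn
    refine ((hreg n).trans ?_).trans_lt hn
    gcongr
    refine le_trans (le_of_eq ?_) (add_le_add_left (hle n) _)
    rw [← timeAvg_add]
    congr 1
    funext i
    exact linLoss_eq _ _ _

end Vote

end PatternPrediction

end

/-! ### The limit for the randomized scheme -/

theorem theorem5 {d : ℕ}
    (P : ℕ → PatternPrediction.FinitePartition (EuclideanSpace ℝ (Fin d)))
    (hP_meas : ∀ l, 1 ≤ l → ∀ j, MeasurableSet ((P l).cell j))
    (hP_nested : ∀ l, 1 ≤ l → (P (l + 1)).Refines (P l))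
    (hP_diam : ∀ r : ℝ, 0 < r →
      Tendsto (fun l => (P l).maxDiamOn (Metric.closedBall 0 r)) atTop (𝓝 0))
    {Ω : Type*} [MeasurableSpace Ω] (μ : Measure Ω) [IsProbabilityMeasure μ]
    (X : ℤ → Ω → EuclideanSpace ℝ (Fin d)) (Y : ℤ → Ω → Fin 2) (U : ℕ → Ω → ℝ)
    (hX : ∀ n, Measurable (X n)) (hY : ∀ n, Measurable (Y n))
    (hXY : PatternPrediction.IsStationaryErgodic μ (fun n ω => (X n ω, Y n ω)))
    (hU : ∀ i, 1 ≤ i → Measurable (U i))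
    (hU_unif : ∀ i, 1 ≤ i → μ.map (U i) = volume.restrict (Set.Icc (0 : ℝ) 1))
    (hU_indep : iIndepFun (fun i : ℕ => U (i + 1)) μ)
    (hU_XY : IndepFun (fun ω (i : ℕ) => U (i + 1) ω) (fun ω (n : ℤ) => (X n ω, Y n ω)) μ) :
    ∀ᵐ ω ∂μ, Tendsto
      (fun n : ℕ => PatternPrediction.schemeLoss P n (fun i => Y i ω) (fun i => X i ω)
        (fun i => U i ω))
      atTop (𝓝 (PatternPrediction.bayesError μ X Y)) := by
  open PatternPrediction in
  have hZ : Measurable fun ω (n : ℤ) => (X n ω, Y n ω) :=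
    measurable_pi_lambda _ fun n => (hX n).prodMk (hY n)
  have : IsProbabilityMeasure (μ.map fun ω (n : ℤ) => (X n ω, Y n ω)) :=
    Measure.isProbabilityMeasure_map hZ.aemeasurable
  have h1 := ae_of_ae_map hZ.aemeasurable
    (ae_tendsto_timeAvg_linLoss_voteShare hXY hP_meas hP_nested hP_diam)
  rw [← bayesError_eq hX hY] at h1
  have h2 := ae_tendsto_timeAvg_threshold hZ hU hU_unif hU_indep hU_XY
    (a := fun i z => voteShare P i (outcomes z) (sideInfo z))
    (c := fun i z => 1 - 2 * bit (outcomes z i))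
    (fun i => measurable_voteShare hP_meas (fun j _ => measurable_coord_snd j)
      fun j _ => measurable_coord_fst j)
    (fun i z => voteShare_nonneg _ _ _ _) (fun i z => voteShare_le_one _ _ _ _)
    (fun i => measurable_const.sub (measurable_const.mul
      (measurable_bit.comp (measurable_coord_snd i))))
    (fun i z => abs_one_sub_two_mul_le (bit_nonneg _) (bit_le_one _))
  filter_upwards [h1, h2] with ω h1 h2
  -- For a decision `s` and share `a`, the realized loss is `linLoss a y + (s - a) * (1 - 2 * y)`:
  -- exactly the two averages just controlled.
  have h := h1.add h2
  rw [add_zero] at h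
  refine h.congr fun n => ?_
  rw [← timeAvg_add, schemeLoss, avgLoss, timeAvg]
  congr 1
  · refine Finset.sum_congr rfl fun i _ => ?_
    rw [ite_ne_eq_bit, bit_scheme, linLoss]
    ring
  · push_cast
    ring
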